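/- **Setting.** Consider a calorically perfect gas ($P=\rho RT$, $\gamma>1$, $R>0$, $c_v=R/(\gamma-1)$) with viscosity $\mu(T)\ge 0$ and conductivity $\kappa(T)\ge 0$, conservative variables $\mathbf U=(\rho,\rho\mathbf V,\rho E)$, thermodynamic entropy $s=c_v\ln T-R\ln\rho$, entropy $\mathcal S=-\rho s$, entropy flux $\mathcal F_m=-\rho sV_m$, entropy variables $\mathbf w=\mathcal S_{\mathbf U}$, inviscid fluxes $\mathbf F_m$ and potentials $\psi_m=\mathbf w^\top\mathbf F_m-\mathcal F_m$. A state is admissible if $\rho>0$ and $T>0$. Let $\bar f_{(S)}$ be a symmetric, consistent two-point flux with $(\mathbf w_1-\mathbf w_2)^\top \bar f_{(S),m}(\mathbf U_1,\mathbf U_2)=\psi_{m,1}-\psi_{m,2}$ for all admissible states. The domain is divided into finitely many hexahedra, each carrying the tensor product of the $N=p+1$ Legendre–Gauss–Lobatto (LGL) points, with one-dimensional diagonal-norm SBP operators $D=\mathcal P^{-1}\mathcal Q$, $\mathcal Q+\mathcal Q^\top=B=\mathrm{diag}(-1,0,\dots,0,1)$, extended by tensor products: $\mathcal P=\mathcal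 P_{N}\otimes\mathcal P_{N}\otimes\mathcal P_{N}$, and $\mathcal P_{\xi^l},D_{\xi^l},\Delta_{\xi^l}$ act in direction $\xi^l$, where $\Delta$ is the two-point difference from flux points $\bar 0,\dots,\bar N$ to solution points $1,\dots,N$. The Jacobians $J$ are positive, the discrete metric terms $\hat{\mathbf a}^l$ ($\hat a^l_m\approx J\,\partial\xi^l/\partial x^m$) satisfy the discrete geometric conservation law $\sum_l D_{\xi^l}\hat a^l_m=0$, and the outward normals $\mathbf n=\pm\hat{\mathbf a}^l$ of collocated face points of neighbouring elements are opposite, with equal face weights $\mathcal P_\perp$. **The scheme.** With $\hat{\mathbf U}=[J]\mathbf U$ and a limiter $\theta_f^k\in[0,1]$ that is chosen independently on each element $k$, the scheme is $$\frac{d\hat{\mathbf U}}{dt}=\theta_f^k\Big(\frac{d\hat{\mathbf U}}{dt}\Big)_p+(1-\theta_f^k)\Big(\frac{d\hat{\mathbf U}}{dt}\Big)_1+\Big(\frac{d\hat{\mathbf U}}{dt}\Big)_{AD},$$ $$\Big(\frac{d\hat{\mathbf U}}{dt}\Big)_p=\sum_{l=1}^3-\mathcal P_{\xi^l}^{-1}\Delta_{\xi^l}\hat{\bar{\mathbf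 f}}_l+D_{\xi^l}\hat{\mathbf f}^{(v)}_l+\mathcal P_{\xi^l}^{-1}\hat{\mathbf g}_l,\qquad \Big(\frac{d\hat{\mathbf U}}{dt}\Big)_1=\sum_{l=1}^3-\mathcal P_{\xi^l}^{-1}\Delta_{\xi^l}\hat{\bar{\mathbf f}}^{(MR)}_l+D_{\xi^l}\hat{\mathbf f}^{(v)}_l+\mathcal P_{\xi^l}^{-1}\hat{\mathbf g}_l,$$ $$\Big(\frac{d\hat{\mathbf U}}{dt}\Big)_{AD}=\sum_{l=1}^3\mathcal P_{\xi^l}^{-1}\Delta_{\xi^l}\big[(1-\theta_f^k)\hat{\bar{\mathbf f}}^{(AD_1)}_{\hat{\bar\sigma},l}+\hat{\bar{\mathbf f}}^{(AD_1)}_l\big]+D_{\xi^l}\hat{\mathbf f}^{(AD_p)}_l+\mathcal P_{\xi^l}^{-1}\big[\hat{\mathbf g}^{(AD_1)}_l+\hat{\mathbf g}^{(AD_p)}_l\big].$$ *Inviscid fluxes.* At flux point $\bar i$, $1\le i\le N-1$, of a line in direction $\xi^l$, $$\hat{\bar{\mathbf f}}_l=\sum_{j>i}\sum_{r\le i}2q_{r,j}\,\bar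 f_{(S)}(\mathbf U_r,\mathbf U_j)\cdot\tfrac12(\hat{\mathbf a}^l_r+\hat{\mathbf a}^l_j),\quad \hat{\bar{\mathbf f}}^{(EC)}_l=\bar f_{(S)}(\mathbf U_i,\mathbf U_{i+1})\cdot\bar{\mathbf a}^l,\quad \bar{\mathbf a}^l=\sum_{j>i}\sum_{r\le i}2q_{r,j}\tfrac12(\hat{\mathbf a}^l_r+\hat{\mathbf a}^l_j),$$ and both fluxes equal $\bar f_{(S)}(\mathbf U,\mathbf U)\cdot\hat{\mathbf a}^l$ at the two end points. The Merriam–Roe flux is $\hat{\bar{\mathbf f}}^{(MR)}_l=\hat{\bar{\mathbf f}}^{(EC)}_l-\hat{\bar{\mathbf f}}^{(ED)}_l$, where $\hat{\bar{\mathbf f}}^{(ED)}_l=\frac12 Y|\Lambda|Y^\top(\mathbf w_{i+1}-\mathbf w_i)$ at interior flux points and $0$ at the ends; $\Lambda$ and $Y$ are the eigenvalues and right eigenvectors of the inviscid flux Jacobian in direction $\bar{\mathbf a}^l$ at an admissible symmetric average of the two states, scaled so that $YY^\top=\mathcal S_{\mathbf U\mathbf U}^{-1}$. *Viscous fluxes.*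 $\hat{\mathbf f}_l=\sum_m\hat a^l_m\mathbf f_{x^m}$ with $\mathbf f_{x^m}=\sum_jc_{m,j}\boldsymbol\Theta_{x^j}$ and $\boldsymbol\Theta_{x^j}=\sum_l\hat a^l_jJ^{-1}(D_{\xi^l}\mathbf w+\mathcal P_{\xi^l}^{-1}\hat{\mathbf g}^{\Theta}_l)$, where $c_{m,j}$ are the coefficient matrices of the viscous flux of the Navier–Stokes equations (for $(v)$) or of the Brenner–Navier–Stokes equations, whose flux is the Navier–Stokes one plus $\sigma\,\partial_{x_m}\rho\,(1,\mathbf V,E)^\top$, written in terms of $\nabla\mathbf w$. For $(AD_p)$ one uses the Brenner flux with $\mu=\mu_p^{AD}$, $\kappa=c_T\mu_p^{AD}$, $\sigma=c_\rho\mu_p^{AD}/\rho$, where $c_\rho,c_T>0$ and $0\le\mu_p^{AD}\le\mu^{AD}$ are any fields single-valued at interfaces. *First-order dissipation.* $\hat{\bar{\mathbf f}}^{(AD_1)}_l$ is, at interior flux points, the two-point Brenner flux $\frac1{\bar J\,\Delta\xi}\sum_{m,j}\bar a^l_m\bar a^l_j\,\bar c_{m,j}(\mathbf w_{i+1}-\mathbf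 w_i)$ (and $0$ at the end points). Here $\bar J$ is the mean Jacobian, $\Delta\xi$ is the point spacing, and the quantities in $\bar c_{m,j}$ are symmetric averages with positive density and temperatures. Its coefficients are $\mu=\bar\mu_1^{AD}$, the two-point mean of $\mu^{AD}-\mu_p^{AD}$, $\kappa=c_T\bar\mu_1^{AD}$ and $\sigma=\bar\sigma_1^{AD}=\max\big(\chi\,\bar\sigma_{\min},\,c_\rho\bar\mu_1^{AD}/\sqrt{\rho_i\rho_{i+1}}\big)$, where $\chi=0$ at interior flux points, $\chi\in\{0,1\}$ at interfaces, and $\bar\sigma_{\min}$ is any given coefficient, single-valued (like $\chi$) at interfaces. The flux $\hat{\bar{\mathbf f}}^{(AD_1)}_{\hat{\bar\sigma},l}$ is the same with $\mu=\kappa=0$ and $\sigma=\hat{\bar\sigma}_1=\max(\bar\sigma_{\min}-\bar\sigma_1^{AD},0)$ on any chosen set of elements, and $\hat{\bar\sigma}_1=0$ on the others. *Interface penalties.* At a face point with outward normal $\mathbf n$, sign $\varsigma=\pm1$ of the side, inner state $-$ and neighbouring state $+$, with $\delta=\mathbf w^+-\mathbf w^-$: $\hat{\mathbf g}^\Theta=\frac{\varsigma}{2}\delta$.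 The inviscid penalty is $\mathbf F(\mathbf U^-)\cdot\mathbf n-\big[\bar f_{(S)}(\mathbf U^-,\mathbf U^+)\cdot\mathbf n-\frac12Y|\Lambda|Y^\top\delta\big]$. The viscous and $AD_p$ penalties are $\frac12(\mathbf f^+-\mathbf f^-)\cdot\mathbf n+\eta\sum_{m,j}n_mn_j\bar c_{m,j}\delta$ with $\eta\ge0$ single-valued at interfaces (possibly $0$) and with the two-sided means of the respective coefficients $\mu,\kappa,\sigma$. The $AD_1$ penalty is the two-point Brenner flux across the interface, $\frac1{\bar Jh}\sum_{m,j}n_mn_j\bar c_{m,j}\delta$, with the coefficients $\bar\mu_1^{AD},\bar\sigma_1^{AD}$ at the interface and $h$ the mean of the two adjacent weights of $\mathcal P_N$. At physical boundary points all penalties $\hat{\mathbf g}^{\Theta},\hat{\mathbf g}^{(inv)},\hat{\mathbf g}^{(v)},\hat{\mathbf g}^{(AD_p)},\hat{\mathbf g}^{(AD_1)}$ are arbitrary. The boundary contributions to the entropy balance are, with sums over the physical boundary points, $$\mathcal B^{inv}=\sum\mathcal P_\perp\big(-\mathcal F\cdot\mathbf n+\mathbf w^\top\hat{\mathbf g}^{(inv)}\big),\qquad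 \mathcal B^{q}=\sum\mathcal P_\perp\big(\mathbf w^\top(\mathbf f^{(q)}\cdot\mathbf n+\hat{\mathbf g}^{(q)})+(\hat{\mathbf g}^{\Theta})^\top\hat{\mathbf f}^{(q)}_l\big)\ (q=v,AD_p),\qquad \mathcal B^{AD_1}=\sum\mathcal P_\perp\mathbf w^\top\hat{\mathbf g}^{(AD_1)},$$ and $\mathcal B=\mathcal B^{inv}+\mathcal B^{v}+\mathcal B^{AD_p}+\mathcal B^{AD_1}$. **Theorem.** For all limiter values $\theta_f^k\in[0,1]$ and every admissible discrete state, the following hold. 1. (Entropy stability.) If $\mathbf U(t)$ satisfies the scheme at a time $t$ at which it equals this state, then the total entropy $\sum_k\mathbf 1^\top\widehat{\mathcal P}[J]\mathcal S$ is differentiable at $t$ and $$\frac{d}{dt}\sum_k\mathbf 1^\top\widehat{\mathcal P}[J]_k\mathcal S(\mathbf U_k)=\sum_k\mathbf w_k^\top\mathcal P\frac{d\hat{\mathbf U}_k}{dt}\le\mathcal B .$$ In particular the rate is $\le0$ if the boundary conditions are entropy stable ($\mathcal B\le0$) or if there is no physical boundary (periodic case). 2. (Blending.) On every element and for every direction $l$,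 $$\mathbf w^\top\mathcal P\mathcal P_{\xi^l}^{-1}\Delta_{\xi^l}\big[\theta_f^k\hat{\bar{\mathbf f}}_l+(1-\theta_f^k)\hat{\bar{\mathbf f}}^{(EC)}_l\big]=\mathbf w^\top\mathcal P\mathcal P_{\xi^l}^{-1}\Delta_{\xi^l}\hat{\bar{\mathbf f}}_l,$$ and the blended flux is entropy conservative: the sum over $l$ of the left-hand sides equals the entropy flux $\sum\mathcal P_\perp\,\mathcal F\cdot\mathbf n$ through the faces of the element. 3. (Dissipation.) The viscous terms, the high-order and the first-order artificial dissipation terms, each with its penalties and (for the last) for the given limiter, are entropy dissipative: their contributions $\sum_k\mathbf w_k^\top\mathcal P(\cdot)$ are at most $\mathcal B^{v}$, $\mathcal B^{AD_p}$ and $\mathcal B^{AD_1}$, respectively. -/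

import Mathlib

noncomputable section

namespace ESFlux

/-! ## Ideal gas: states, fluxes, entropy -/

/-- Vectors of the five conservative (or entropy) variables. A state is
`U = (ρ, ρ V₁, ρ V₂, ρ V₃, ρ E)`. -/
abbrev Vec5 : Type := Fin 5 → ℝ

/-- Assemble a five-vector from its mass, momentum and energy parts. -/
def vec5 (a : ℝ) (b : Fin 3 → ℝ) (c : ℝ) : Vec5 := ![a, b 0, b 1, b 2, c]

/-- The momentum part of a five-vector. -/
def momPart (x : Vec5) : Fin 3 → ℝ := ![x 1, x 2, x 3]

/-- A calorically perfect gas with specific gas constant `R`, ratio of specific heats `γ`, and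
temperature dependent dynamic viscosity and thermal conductivity. -/
structure Gas where
  R : ℝ
  gamma : ℝ
  R_pos : 0 < R
  gamma_gt_one : 1 < gamma
  mu : ℝ → ℝ
  kappa : ℝ → ℝ
  mu_nonneg : ∀ T, 0 < T → 0 ≤ mu T
  kappa_nonneg : ∀ T, 0 < T → 0 ≤ kappa T

variable (G : Gas)

/-- Specific heat at constant volume. -/
def Gas.cv : ℝ := G.R / (G.gamma - 1)

def density (U : Vec5) : ℝ := U 0

def velocity (U : Vec5) : Fin 3 → ℝ := fun i => momPart U i / U 0

/-- Specific total energy `E`. -/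
def energy (U : Vec5) : ℝ := U 4 / U 0

/-- `c_v T = E - |V|² / 2`. -/
def temperature (U : Vec5) : ℝ := (energy U - (∑ i, velocity U i ^ 2) / 2) / G.cv

def pressure (U : Vec5) : ℝ := density U * G.R * temperature G U

/-- Specific total enthalpy `H = E + P / ρ`. -/
def enthalpy (U : Vec5) : ℝ := energy U + pressure G U / density U

/-- Positive density and temperature. -/
def Admissible (U : Vec5) : Prop := 0 < density U ∧ 0 < temperature G U

/-- Thermodynamic entropy `s` of the gas. -/
def thermoEntropy (U : Vec5) : ℝ :=
  G.cv * Real.log (temperature G U) - G.R * Real.log (density U)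

/-- The scalar mathematical entropy `S = -ρ s`. -/
def entropy (U : Vec5) : ℝ := -(density U * thermoEntropy G U)

/-- The entropy flux `-ρ s V` in the direction `x_m`. -/
def entropyFlux (U : Vec5) (m : Fin 3) : ℝ := -(density U * thermoEntropy G U * velocity U m)

/-- The entropy variables `w = S_U`. -/
def entropyVars (U : Vec5) : Vec5 := fun a => fderiv ℝ (entropy G) U (Pi.single a 1)

/-- The inviscid flux in the direction `x_m`. -/
def eulerFlux (U : Vec5) (m : Fin 3) : Vec5 :=
  vec5 (density U * velocity U m)
    (fun i => density U * velocity U m * velocity U i + if m = i then pressure G U else 0)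
    (density U * velocity U m * enthalpy G U)

/-- The entropy potential `ψ_m = wᵀ F_m - 𝓕_m`. -/
def entropyPotential (U : Vec5) (m : Fin 3) : ℝ :=
  dotProduct (entropyVars G U) (eulerFlux G U m) - entropyFlux G U m

/-- A symmetric, consistent, entropy conservative two-point flux; `toFun U₁ U₂ m` is its
component in the direction `x_m`. -/
structure ECFlux where
  toFun : Vec5 → Vec5 → Fin 3 → Vec5
  symm : ∀ U₁ U₂, Admissible G U₁ → Admissible G U₂ → toFun U₁ U₂ = toFun U₂ U₁
  consistent : ∀ U, Admissible G U → toFun U U = eulerFlux G U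
  conservative : ∀ U₁ U₂, Admissible G U₁ → Admissible G U₂ → ∀ m,
    dotProduct (entropyVars G U₁ - entropyVars G U₂) (toFun U₁ U₂ m) =
      entropyPotential G U₁ m - entropyPotential G U₂ m

/-- Contraction of a triple of Cartesian fluxes with a (metric or normal) vector. -/
def contract (n : Fin 3 → ℝ) (f : Fin 3 → Vec5) : Vec5 := ∑ m, n m • f m

/-! ## Merriam-Roe dissipation -/

/-- A symmetric two-point average of states that preserves admissibility. -/
structure StateMean where
  toFun : Vec5 → Vec5 → Vec5
  symm : ∀ U₁ U₂, Admissible G U₁ → Admissible G U₂ → toFun U₁ U₂ = toFun U₂ U₁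
  admissible : ∀ U₁ U₂, Admissible G U₁ → Admissible G U₂ → Admissible G (toFun U₁ U₂)

def soundSpeed (U : Vec5) : ℝ := Real.sqrt (G.gamma * G.R * temperature G U)

def norm3 (n : Fin 3 → ℝ) : ℝ := Real.sqrt (∑ m, n m ^ 2)

/-- The matrix-vector product `Y |Λ| Yᵀ x`, where `Λ` holds the eigenvalues `V·n`, `V·n ± c|n|` of
the inviscid flux Jacobian in the direction `n` and the columns of `Y` are its right eigenvectors,
scaled so that `Y Yᵀ = (S_UU)⁻¹`. With `ν = n / |n|` the scaled columns are
`√((γ-1)ρ/(γR)) (1, V, |V|²/2)` (entropy wave), `√(ρ/(2γR)) (1, V ± cν, H ± c V·ν)` (acoustic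
waves), and, for the shear waves, the sum of `y yᵀ` over an orthonormal pair of tangents `t`,
`y = √(ρT) (0, t, V·t)`, is written as the same sum over the three projections
`t = e_i - ν_i ν`. -/
def roeDissipation (U : Vec5) (n : Fin 3 → ℝ) (x : Vec5) : Vec5 :=
  let V := velocity U
  let ν : Fin 3 → ℝ := fun i => n i / norm3 n
  let Vn := ∑ i, V i * n i
  let Vν := ∑ i, V i * ν i
  let c := soundSpeed G U
  let rEnt := vec5 1 V ((∑ i, V i ^ 2) / 2)
  let rPlus := vec5 1 (fun i => V i + c * ν i) (enthalpy G U + c * Vν)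
  let rMinus := vec5 1 (fun i => V i - c * ν i) (enthalpy G U - c * Vν)
  let tang : Fin 3 → Fin 3 → ℝ := fun i j => (if i = j then 1 else 0) - ν i * ν j
  let rShear : Fin 3 → Vec5 := fun i => vec5 0 (tang i) (∑ j, V j * tang i j)
  (|Vn| * ((G.gamma - 1) * density U / (G.gamma * G.R)) * dotProduct rEnt x) • rEnt
    + (|Vn + c * norm3 n| * (density U / (2 * G.gamma * G.R)) * dotProduct rPlus x) • rPlus
    + (|Vn - c * norm3 n| * (density U / (2 * G.gamma * G.R)) * dotProduct rMinus x) • rMinus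
    + ∑ i, (|Vn| * (density U * temperature G U) * dotProduct (rShear i) x) • rShear i

/-! ## Navier-Stokes and Brenner viscous fluxes in terms of entropy-variable gradients -/

/-- The quantities at which viscous coefficient matrices are evaluated. At a solution point both
temperatures are the local one; a two-point mean may average them differently in the stress and
in the heat flux. -/
structure TransportState where
  rho : ℝ
  vel : Fin 3 → ℝ
  energy : ℝ
  tempStress : ℝ
  tempHeat : ℝ

def TransportState.ofState (U : Vec5) : TransportState where
  rho := density U
  vel := velocity U
  energy := ESFlux.energy U
  tempStress := temperature G U
  tempHeat := temperature G U

/-- A symmetric two-point mean of the quantities in the viscous coefficient matrices. -/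
structure TransportMean where
  toFun : Vec5 → Vec5 → TransportState
  symm : ∀ U₁ U₂, Admissible G U₁ → Admissible G U₂ → toFun U₁ U₂ = toFun U₂ U₁
  rho_pos : ∀ U₁ U₂, Admissible G U₁ → Admissible G U₂ → 0 < (toFun U₁ U₂).rho
  tempStress_pos : ∀ U₁ U₂, Admissible G U₁ → Admissible G U₂ → 0 < (toFun U₁ U₂).tempStress
  tempHeat_pos : ∀ U₁ U₂, Admissible G U₁ → Admissible G U₂ → 0 < (toFun U₁ U₂).tempHeat

/-- The Brenner-Navier-Stokes viscous flux in the direction `x_m` with viscosity `μ`, conductivity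
`κ` and volume diffusivity `σ`, as a linear function `∑ j, c_{m,j} Θ_j` of the gradient
`Θ_j = ∂w/∂x_j` of the entropy variables. The chain rule gives
`∂V_i = T (∂w_{i+1} + V_i ∂w_5)`, `∂T = T² ∂w_5`, `∂ρ = (ρ/R) (∂w_1 + ∑ V_i ∂w_{i+1} + E ∂w_5)`.
The Navier-Stokes flux is the case `σ = 0`. -/
def brennerFlux (μ κ σ : ℝ) (A : TransportState) (Θ : Fin 3 → Vec5) (m : Fin 3) : Vec5 :=
  let dV : Fin 3 → Fin 3 → ℝ := fun i j => A.tempStress * (momPart (Θ j) i + A.vel i * Θ j 4)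
  let dT : Fin 3 → ℝ := fun j => A.tempHeat ^ 2 * Θ j 4
  let dρ : Fin 3 → ℝ := fun j =>
    A.rho / G.R * (Θ j 0 + (∑ i, A.vel i * momPart (Θ j) i) + A.energy * Θ j 4)
  let τ : Fin 3 → ℝ := fun i =>
    μ * (dV i m + dV m i - if i = m then 2 / 3 * ∑ r, dV r r else 0)
  vec5 0 τ ((∑ i, τ i * A.vel i) + κ * dT m) + (σ * dρ m) • vec5 1 A.vel A.energy

/-- The two-point Brenner flux through a face with normal `n`, driven by a jump `δ` of the entropy
variables in the direction of `n`: `∑ m j, n_m n_j c_{m,j} δ`. -/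
def normalBrenner (μ κ σ : ℝ) (A : TransportState) (n : Fin 3 → ℝ) (δ : Vec5) : Vec5 :=
  contract n (brennerFlux G μ κ σ A (fun j => n j • δ))

/-! ## One-dimensional summation-by-parts operators on Legendre-Gauss-Lobatto points -/

/-- The collocation operators of degree `p` on `p + 1` points of `[-1, 1]`: diagonal norm `P`,
stiffness matrix `Q` with `Q + Qᵀ = B`, and `P⁻¹ Q` differentiates polynomials of degree at most
`p` exactly. (With the end points included, these conditions characterize the
Legendre-Gauss-Lobatto points and weights.) -/
structure LGL (p : ℕ) where
  node : Fin (p + 1) → ℝ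
  P : Fin (p + 1) → ℝ
  Q : Fin (p + 1) → Fin (p + 1) → ℝ
  node_strictMono : StrictMono node
  node_first : node 0 = -1
  node_last : node (Fin.last p) = 1
  P_pos : ∀ i, 0 < P i
  sbp : ∀ i j, Q i j + Q j i =
    if i = j then (if i = Fin.last p then 1 else 0) - (if i = 0 then 1 else 0) else 0
  exact : ∀ f : Polynomial ℝ, f.natDegree ≤ p → ∀ i,
    ∑ j, Q i j * f.eval (node j) = P i * (Polynomial.derivative f).eval (node i)

/-! ## Tensor-product elements and meshes -/

/-- Solution points of the reference hexahedron. -/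
abbrev Node (p : ℕ) : Type := Fin 3 → Fin (p + 1)

/-- First (`false`) or last (`true`) index of a one-dimensional line of points. -/
def endIdx (p : ℕ) (s : Bool) : Fin (p + 1) := if s then Fin.last p else 0

/-- Sign of the outward normal in the reference element. -/
def sgn (s : Bool) : ℝ := if s then 1 else -1

/-- A solution point of a given element seen from one of the element faces it lies on:
`(element, computational direction, side, point)`. -/
def FaceNode (p : ℕ) (E : Type*) : Type _ :=
  {f : E × Fin 3 × Bool × Node p // f.2.2.2 f.2.1 = endIdx p f.2.2.1}

instance (p : ℕ) (E : Type*) [Fintype E] : Fintype (FaceNode p E) :=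
  inferInstanceAs (Fintype
    {f : E × Fin 3 × Bool × Node p // f.2.2.2 f.2.1 = endIdx p f.2.2.1})

namespace FaceNode

variable {p : ℕ} {E : Type*}

def elem (f : FaceNode p E) : E := f.1.1
def dir (f : FaceNode p E) : Fin 3 := f.1.2.1
def side (f : FaceNode p E) : Bool := f.1.2.2.1
def pt (f : FaceNode p E) : Node p := f.1.2.2.2

end FaceNode

variable {p : ℕ}

/-- Diagonal entry of `P ⊗ P ⊗ P`. -/
def LGL.weight (L : LGL p) (i : Node p) : ℝ := ∏ l, L.P (i l)

/-- Diagonal entry of the norm on faces orthogonal to the direction `l`. -/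
def LGL.faceWeight (L : LGL p) (l : Fin 3) (i : Node p) : ℝ :=
  ∏ m ∈ Finset.univ.erase l, L.P (i m)

/-- The one-dimensional derivative operator applied in the direction `l`. -/
def LGL.deriv (L : LGL p) (l : Fin 3) (f : Node p → Vec5) (i : Node p) : Vec5 :=
  (L.P (i l))⁻¹ • ∑ r, L.Q (i l) r • f (Function.update i l r)

/-- A curvilinear hexahedral mesh with elements `E`: discrete metric terms
`metric k i l m ≈ J ∂ξ^l/∂x^m` satisfying the discrete geometric conservation law, positive
Jacobians, and a conforming gluing of collocated face points. Face points with `nbr f = none` lie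
on the physical boundary; a periodic mesh has none. -/
structure HexMesh (L : LGL p) (E : Type*) where
  metric : E → Node p → Fin 3 → Fin 3 → ℝ
  jac : E → Node p → ℝ
  jac_pos : ∀ k i, 0 < jac k i
  gcl : ∀ k i m,
    ∑ l, (L.P (i l))⁻¹ * ∑ r, L.Q (i l) r * metric k (Function.update i l r) l m = 0
  nbr : FaceNode p E → Option (FaceNode p E)
  nbr_symm : ∀ f g, nbr f = some g → nbr g = some f
  weight_match : ∀ f g, nbr f = some g →
    L.faceWeight f.dir f.pt = L.faceWeight g.dir g.pt
  normal_match : ∀ f g, nbr f = some g → ∀ m,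
    sgn g.side * metric g.elem g.pt g.dir m = -(sgn f.side * metric f.elem f.pt f.dir m)

variable {L : LGL p} {E : Type*} (M : HexMesh L E)

/-- The outward contravariant normal at a face point. -/
def HexMesh.normal (f : FaceNode p E) : Fin 3 → ℝ :=
  fun m => sgn f.side * M.metric f.elem f.pt f.dir m

/-- The values of the conservative variables at all solution points. -/
abbrev GridFunction (p : ℕ) (E : Type*) : Type _ := E → Node p → Vec5

/-- Collect, at the solution point `i` of element `k`, the penalties of the (zero, one or two) faces
orthogonal to the direction `l` that contain it. -/
def facePenalty (g : FaceNode p E → Vec5) (k : E) (l : Fin 3) (i : Node p) : Vec5 :=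
  ∑ s : Bool, if h : i l = endIdx p s then g ⟨(k, l, s, i), h⟩ else 0

/-! ## Flux points -/

/-- Values at the `p + 2` flux points of a line from the values at both ends and at the `p` interior
flux points; the interior flux point `c` lies between the solution points `c` and `c + 1`. -/
def lineFlux (left : Vec5) (inner : Fin p → Vec5) (right : Vec5) : Fin (p + 2) → Vec5 :=
  Fin.cons left (Fin.snoc inner right)

/-- A flux at the flux points: `f k l i j` is its value at the `j`-th flux point of the line in the
direction `l` through the solution point `i` of element `k`. -/
abbrev PointFlux (p : ℕ) (E : Type*) : Type _ := E → Fin 3 → Node p → Fin (p + 2) → Vec5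

/-- The telescopic operator `P_l⁻¹ Δ_l`. -/
def telescope (L : LGL p) (f : PointFlux p E) (k : E) (l : Fin 3) (i : Node p) : Vec5 :=
  (L.P (i l))⁻¹ • (f k l i (i l).succ - f k l i (i l).castSucc)

/-- Metric terms at the interior flux points. -/
def HexMesh.fluxMetric (k : E) (l : Fin 3) (i : Node p) (c : Fin p) (m : Fin 3) : ℝ :=
  ∑ j ∈ Finset.Ici c.succ, ∑ r ∈ Finset.Iic c.castSucc,
    2 * L.Q r j * ((M.metric k (Function.update i l r) l m
      + M.metric k (Function.update i l j) l m) / 2)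

/-- The entropy conservative flux evaluated at the first or last point of a line. -/
def endFlux (F : ECFlux G) (U : GridFunction p E) (k : E) (l : Fin 3) (i : Node p) (s : Bool) : Vec5 :=
  let e := Function.update i l (endIdx p s)
  contract (M.metric k e l) (F.toFun (U k e) (U k e))

/-- The high-order entropy conservative flux. -/
def highFlux (F : ECFlux G) (U : GridFunction p E) : PointFlux p E := fun k l i =>
  lineFlux (endFlux G M F U k l i false)
    (fun c => ∑ j ∈ Finset.Ici c.succ, ∑ r ∈ Finset.Iic c.castSucc,
      (2 * L.Q r j) • contract
        (fun m => (M.metric k (Function.update i l r) l m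
          + M.metric k (Function.update i l j) l m) / 2)
        (F.toFun (U k (Function.update i l r)) (U k (Function.update i l j))))
    (endFlux G M F U k l i true)

/-- The first-order entropy conservative flux. -/
def lowFlux (F : ECFlux G) (U : GridFunction p E) : PointFlux p E := fun k l i =>
  lineFlux (endFlux G M F U k l i false)
    (fun c => contract (M.fluxMetric k l i c)
      (F.toFun (U k (Function.update i l c.castSucc)) (U k (Function.update i l c.succ))))
    (endFlux G M F U k l i true)

/-- Jump of the entropy variables across an interior flux point. -/
def jumpW (U : GridFunction p E) (k : E) (l : Fin 3) (i : Node p) (c : Fin p) : Vec5 :=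
  entropyVars G (U k (Function.update i l c.succ))
    - entropyVars G (U k (Function.update i l c.castSucc))

/-- The Merriam-Roe entropy dissipative part of the first-order flux; it acts at interior flux
points (its interface counterpart is part of the interface penalty). -/
def dissFlux (A : StateMean G) (U : GridFunction p E) : PointFlux p E := fun k l i =>
  lineFlux 0
    (fun c => (1 / 2 : ℝ) • roeDissipation G
      (A.toFun (U k (Function.update i l c.castSucc)) (U k (Function.update i l c.succ)))
      (M.fluxMetric k l i c) (jumpW G U k l i c))
    0

/-- The first-order Merriam-Roe flux. -/
def merriamRoeFlux (F : ECFlux G) (A : StateMean G) (U : GridFunction p E) : PointFlux p E :=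
  fun k l i j => lowFlux G M F U k l i j - dissFlux G M A U k l i j

/-! ## Artificial viscosity and scheme parameters -/

/-- Artificial viscosity data. `muAD` is the globally continuous artificial viscosity, `muP` the
part used by the high-order dissipation. `sigmaMin` is the minimum mass diffusion, given at the
interior flux point that follows the solution point `i` in the direction `l`, and
`sigmaMinFace` at element interfaces; `chi` marks interfaces collocated with limited elements, and
`lowDensity` marks elements on which additional interior mass diffusion is required. -/
structure ArtVisc where
  cRho : ℝ
  cT : ℝ
  cRho_pos : 0 < cRho
  cT_pos : 0 < cT
  muAD : E → Node p → ℝ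
  muP : E → Node p → ℝ
  muP_nonneg : ∀ k i, 0 ≤ muP k i
  muP_le : ∀ k i, muP k i ≤ muAD k i
  muAD_match : ∀ f g, M.nbr f = some g → muAD f.elem f.pt = muAD g.elem g.pt
  muP_match : ∀ f g, M.nbr f = some g → muP f.elem f.pt = muP g.elem g.pt
  sigmaMin : E → Fin 3 → Node p → ℝ
  sigmaMinFace : FaceNode p E → ℝ
  sigmaMinFace_match : ∀ f g, M.nbr f = some g → sigmaMinFace f = sigmaMinFace g
  chi : FaceNode p E → Bool
  chi_match : ∀ f g, M.nbr f = some g → chi f = chi g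
  lowDensity : E → Bool

/-- Penalties imposing the physical boundary conditions, for the gradient of the entropy variables,
the inviscid, viscous, high-order and first-order artificial dissipation terms (used only where
`nbr f = none`). -/
structure BoundaryPenalties (p : ℕ) (E : Type*) where
  theta : FaceNode p E → Vec5
  inviscid : FaceNode p E → Vec5
  viscous : FaceNode p E → Vec5
  adp : FaceNode p E → Vec5
  ad1 : FaceNode p E → Vec5

/-- The choices that enter the scheme. `ip` is the coefficient of the interior-penalty part of the
viscous interface terms; it may be zero. -/
structure SchemeData where
  flux : ECFlux G
  roeMean : StateMean G
  mean : TransportMean G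
  av : ArtVisc M
  bc : BoundaryPenalties p E
  ip : FaceNode p E → ℝ
  ip_nonneg : ∀ f, 0 ≤ ip f
  ip_match : ∀ f g, M.nbr f = some g → ip f = ip g

variable {G M} (D : SchemeData G M) (U : GridFunction p E)

/-- State and entropy variables at a face point, from inside its element. -/
def faceState (f : FaceNode p E) : Vec5 := U f.elem f.pt

variable (G) in
def faceW (f : FaceNode p E) : Vec5 := entropyVars G (faceState U f)

namespace SchemeData

/-! ## Inviscid and viscous terms -/

/-- Inviscid penalty: replaces the flux of the element by the Merriam-Roe flux of the two
collocated states. -/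
def invPenalty (f : FaceNode p E) : Vec5 :=
  match M.nbr f with
  | none => D.bc.inviscid f
  | some g =>
    contract (M.normal f) (eulerFlux G (faceState U f))
      - (contract (M.normal f) (D.flux.toFun (faceState U f) (faceState U g))
        - (1 / 2 : ℝ) • roeDissipation G (D.roeMean.toFun (faceState U f) (faceState U g))
            (M.normal f) (faceW G U g - faceW G U f))

/-- Penalty in the gradient of the entropy variables. -/
def thetaPenalty (f : FaceNode p E) : Vec5 :=
  match M.nbr f with
  | none => D.bc.theta f
  | some g => (sgn f.side / 2) • (faceW G U g - faceW G U f)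

/-- Discrete gradient `Θ_{x^j}` of the entropy variables. -/
def grad (k : E) (i : Node p) (j : Fin 3) : Vec5 :=
  ∑ l, (M.metric k i l j / M.jac k i) •
    (L.deriv l (fun i' => entropyVars G (U k i')) i
      + (L.P (i l))⁻¹ • facePenalty (D.thetaPenalty U) k l i)

/-- The Cartesian viscous fluxes of the Navier-Stokes equations. -/
def viscFlux (k : E) (i : Node p) : Fin 3 → Vec5 :=
  brennerFlux G (G.mu (temperature G (U k i))) (G.kappa (temperature G (U k i))) 0
    (TransportState.ofState G (U k i)) (D.grad U k i)

/-- The Cartesian high-order artificial dissipation fluxes. -/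
def adpFlux (k : E) (i : Node p) : Fin 3 → Vec5 :=
  brennerFlux G (D.av.muP k i) (D.av.cT * D.av.muP k i)
    (D.av.cRho * D.av.muP k i / density (U k i))
    (TransportState.ofState G (U k i)) (D.grad U k i)

/-- Contravariant components of Cartesian fluxes at the solution points. -/
def _root_.ESFlux.HexMesh.contra (M : HexMesh L E) (f : E → Node p → Fin 3 → Vec5)
    (k : E) (l : Fin 3) (i : Node p) : Vec5 :=
  contract (M.metric k i l) (f k i)

/-- Viscous penalty: centered fluxes plus interior-penalty dissipation. -/
def viscPenalty (f : FaceNode p E) : Vec5 :=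
  match M.nbr f with
  | none => D.bc.viscous f
  | some g =>
    (1 / 2 : ℝ) • (contract (M.normal f) (D.viscFlux U g.elem g.pt)
        - contract (M.normal f) (D.viscFlux U f.elem f.pt))
      + D.ip f • normalBrenner G
          ((G.mu (temperature G (faceState U f)) + G.mu (temperature G (faceState U g))) / 2)
          ((G.kappa (temperature G (faceState U f))
            + G.kappa (temperature G (faceState U g))) / 2)
          0 (D.mean.toFun (faceState U f) (faceState U g)) (M.normal f)
          (faceW G U g - faceW G U f)

/-- Penalty of the high-order artificial dissipation, formed as the viscous one. -/
def adpPenalty (f : FaceNode p E) : Vec5 :=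
  match M.nbr f with
  | none => D.bc.adp f
  | some g =>
    (1 / 2 : ℝ) • (contract (M.normal f) (D.adpFlux U g.elem g.pt)
        - contract (M.normal f) (D.adpFlux U f.elem f.pt))
      + D.ip f • normalBrenner G
          ((D.av.muP f.elem f.pt + D.av.muP g.elem g.pt) / 2)
          (D.av.cT * ((D.av.muP f.elem f.pt + D.av.muP g.elem g.pt) / 2))
          ((D.av.cRho * D.av.muP f.elem f.pt / density (faceState U f)
            + D.av.cRho * D.av.muP g.elem g.pt / density (faceState U g)) / 2)
          (D.mean.toFun (faceState U f) (faceState U g)) (M.normal f)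
          (faceW G U g - faceW G U f)

/-! ## First-order artificial dissipation -/

/-- First-order artificial viscosity at an interior flux point. -/
def mu1 (k : E) (l : Fin 3) (i : Node p) (c : Fin p) : ℝ :=
  (D.av.muAD k (Function.update i l c.castSucc) + D.av.muAD k (Function.update i l c.succ)
    - D.av.muP k (Function.update i l c.castSucc) - D.av.muP k (Function.update i l c.succ)) / 2

/-- First-order artificial mass diffusion at an interior flux point (the minimum mass diffusion is
imposed at this level only at interfaces, so it is replaced by `0` here). -/
def sigma1 (k : E) (l : Fin 3) (i : Node p) (c : Fin p) : ℝ :=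
  max 0 (D.av.cRho * D.mu1 k l i c /
    Real.sqrt (density (U k (Function.update i l c.castSucc))
      * density (U k (Function.update i l c.succ))))

/-- Additional mass diffusion at an interior flux point. -/
def sigmaHat (k : E) (l : Fin 3) (i : Node p) (c : Fin p) : ℝ :=
  if D.av.lowDensity k then
    max (D.av.sigmaMin k l (Function.update i l c.castSucc) - D.sigma1 U k l i c) 0
  else 0

/-- First-order artificial viscosity at a face point. -/
def mu1Face (f : FaceNode p E) : ℝ := D.av.muAD f.elem f.pt - D.av.muP f.elem f.pt

/-- First-order artificial mass diffusion at the interface between two face points. -/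
def sigma1Face (f g : FaceNode p E) : ℝ :=
  max ((if D.av.chi f then 1 else 0) * D.av.sigmaMinFace f)
    (D.av.cRho * D.mu1Face f / Real.sqrt (density (faceState U f) * density (faceState U g)))

/-- A two-point Brenner flux at the interior flux points with coefficients `μ, κ, σ`, the gradient
being approximated by `(ā_j / J̄) Δw / Δξ`. -/
def twoPointFlux (μ κ σ : E → Fin 3 → Node p → Fin p → ℝ) : PointFlux p E := fun k l i =>
  lineFlux 0
    (fun c =>
      ((M.jac k (Function.update i l c.castSucc) + M.jac k (Function.update i l c.succ)) / 2
          * (L.node c.succ - L.node c.castSucc))⁻¹ •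
        normalBrenner G (μ k l i c) (κ k l i c) (σ k l i c)
          (D.mean.toFun (U k (Function.update i l c.castSucc)) (U k (Function.update i l c.succ)))
          (M.fluxMetric k l i c) (jumpW G U k l i c))
    0

/-- First-order artificial dissipation flux. -/
def ad1Flux : PointFlux p E :=
  D.twoPointFlux U D.mu1 (fun k l i c => D.av.cT * D.mu1 k l i c) (D.sigma1 U)

/-- First-order mass diffusion flux needed for positivity. -/
def ad1HatFlux : PointFlux p E :=
  D.twoPointFlux U (fun _ _ _ _ => 0) (fun _ _ _ _ => 0) (D.sigmaHat U)

/-- Penalty of the first-order artificial dissipation: the two-point Brenner flux across the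
interface, whose two control volumes have widths given by the weights of the end points. -/
def ad1Penalty (f : FaceNode p E) : Vec5 :=
  match M.nbr f with
  | none => D.bc.ad1 f
  | some g =>
    ((M.jac f.elem f.pt + M.jac g.elem g.pt) / 2
        * ((L.P (f.pt f.dir) + L.P (g.pt g.dir)) / 2))⁻¹ •
      normalBrenner G (D.mu1Face f) (D.av.cT * D.mu1Face f) (D.sigma1Face U f g)
        (D.mean.toFun (faceState U f) (faceState U g)) (M.normal f)
        (faceW G U g - faceW G U f)

/-! ## The semi-discrete schemes -/

/-- Viscous terms `∑ l, D_l f_l + P_l⁻¹ g_l`. -/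
def viscTerms (k : E) (i : Node p) : Vec5 :=
  ∑ l, (L.deriv l (M.contra (D.viscFlux U) k l) i
    + (L.P (i l))⁻¹ • facePenalty (D.viscPenalty U) k l i)

/-- High-order artificial dissipation terms. -/
def adpTerms (k : E) (i : Node p) : Vec5 :=
  ∑ l, (L.deriv l (M.contra (D.adpFlux U) k l) i
    + (L.P (i l))⁻¹ • facePenalty (D.adpPenalty U) k l i)

/-- First-order artificial dissipation terms for the limiter `θ`. -/
def ad1Terms (θ : E → ℝ) (k : E) (i : Node p) : Vec5 :=
  ∑ l, (telescope L
      (fun k' l' i' j => (1 - θ k') • D.ad1HatFlux U k' l' i' j + D.ad1Flux U k' l' i' j) k l i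
    + (L.P (i l))⁻¹ • facePenalty (D.ad1Penalty U) k l i)

/-- The baseline high-order scheme. -/
def highRate (k : E) (i : Node p) : Vec5 :=
  (∑ l, (-telescope L (highFlux G M D.flux U) k l i
    + (L.P (i l))⁻¹ • facePenalty (D.invPenalty U) k l i)) + D.viscTerms U k i

/-- The first-order scheme with the Merriam-Roe flux. -/
def lowRate (k : E) (i : Node p) : Vec5 :=
  (∑ l, (-telescope L (merriamRoeFlux G M D.flux D.roeMean U) k l i
    + (L.P (i l))⁻¹ • facePenalty (D.invPenalty U) k l i)) + D.viscTerms U k i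

/-- The artificial dissipation. -/
def adRate (θ : E → ℝ) (k : E) (i : Node p) : Vec5 := D.ad1Terms U θ k i + D.adpTerms U k i

/-- Right-hand side `dÛ/dt` of the flux-limiting scheme. -/
def limitedRate (θ : E → ℝ) (k : E) (i : Node p) : Vec5 :=
  θ k • D.highRate U k i + (1 - θ k) • D.lowRate U k i + D.adRate U θ k i

end SchemeData

/-! ## Entropy contributions -/

variable (G) in
/-- `wᵀ P X` on element `k`. -/
def elemContribution (L : LGL p) (k : E) (X : Node p → Vec5) : ℝ :=
  ∑ i, L.weight i * dotProduct (entropyVars G (U k i)) (X i)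

variable (G) in
/-- `wᵀ P X` summed over all elements. -/
def contribution [Fintype E] (L : LGL p) (X : E → Node p → Vec5) : ℝ :=
  ∑ k, elemContribution G U L k (X k)

variable (G M) in
/-- The discrete total entropy `∑ k, 1ᵀ P [J] S`. -/
def totalEntropy [Fintype E] : ℝ := ∑ k, ∑ i, L.weight i * (M.jac k i * entropy G (U k i))

variable (M) in
/-- Sum of `φ` over the points of the physical boundary, with the face quadrature weights. -/
def boundarySum [Fintype E] (φ : FaceNode p E → ℝ) : ℝ :=
  ∑ f : FaceNode p E,
    match M.nbr f with
    | none => L.faceWeight f.dir f.pt * φ f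
    | some _ => 0

variable (G M) in
/-- The entropy flux through all six faces of the element `k`. -/
def elemEntropyOutflow (k : E) : ℝ :=
  ∑ l, ∑ s : Bool, ∑ i : Node p,
    if i l = endIdx p s then
      L.faceWeight l i * (sgn s * ∑ m, M.metric k i l m * entropyFlux G (U k i) m)
    else 0

namespace SchemeData

variable [Fintype E]

/-- Inviscid boundary contribution: entropy flux and boundary penalty. -/
def invBoundary : ℝ :=
  boundarySum M fun f =>
    -(∑ m, M.normal f m * entropyFlux G (faceState U f) m)
      + dotProduct (faceW G U f) (D.bc.inviscid f)

/-- Boundary contribution of diffusive terms with Cartesian fluxes `q` and boundary penalty `b`. -/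
def diffBoundary (q : E → Node p → Fin 3 → Vec5) (b : FaceNode p E → Vec5) : ℝ :=
  boundarySum M fun f =>
    dotProduct (faceW G U f) (contract (M.normal f) (q f.elem f.pt) + b f)
      + dotProduct (D.bc.theta f) (M.contra q f.elem f.dir f.pt)

def viscBoundary : ℝ := D.diffBoundary U (D.viscFlux U) D.bc.viscous

def adpBoundary : ℝ := D.diffBoundary U (D.adpFlux U) D.bc.adp

def ad1Boundary : ℝ := boundarySum M fun f => dotProduct (faceW G U f) (D.bc.ad1 f)

/-- All contributions of the physical boundary to the entropy balance. -/
def boundaryContribution : ℝ :=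
  D.invBoundary U + D.viscBoundary U + D.adpBoundary U + D.ad1Boundary U

end SchemeData

end ESFlux

end

open ESFlux

/-!
The proof is the classical summation-by-parts entropy balance. It never needs a formula for the
entropy variables `w`: they enter only through Tadmor's condition `(w₁ - w₂)ᵀ f = ψ₁ - ψ₂` and
through the chain rule `dS/dt = wᵀ dU/dt`.

*Inviscid fluxes.* On a grid line, Abel summation moves the telescopic difference onto the jumps of
`w` at the flux points (`sum_dotProduct_telescope`). A pair of solution points `r < j` of the
high-order flux is counted by every flux point between them, so that the jumps of `w` add up to
`w_j - w_r` (`sum_jump_dotProduct_sum`), and Tadmor's condition turns them into `ψ_j - ψ_r`. For the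
low-order flux Tadmor's condition is applied between neighbours, and the jumps of `ψ` add up in the
same way. Both fluxes therefore do the same interior work on each line (`sum_jump_highFlux`,
`sum_jump_lowFlux`), and so does any blend. As `Q + Qᵀ = B`, this work is a boundary term minus
`∑ ψ Q a` (`LGL.sum_lt_Q`); summed over the directions the latter vanishes by the geometric
conservation law, and the entropy flux through the faces is left
(`elemContribution_blend_eq_outflow`). The Merriam-Roe part of the flux and of the interface penalty
only dissipates, because `Y |Λ| Yᵀ` is positive semidefinite.

*Diffusive fluxes.* Summation by parts produces face terms and the volume term
`-∑ (D_l w)ᵀ f̂_l`; completed by the gradient penalties, the latter is minus the quadratic form of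
the Brenner coefficient matrices in the discrete gradient (`contribution_diffusion`), and this form
is nonnegative (`brennerFlux_nonneg`). The first-order dissipation has the same form with two-point
jumps in place of gradients.

*Interfaces.* The gluing is an involution of the interface points, so a face sum is bounded by its
physical boundary part as soon as the two contributions at each interface add up to at most zero
(`sum_faceWeight_le_boundarySum`). For the centered parts they cancel; for the jump parts they
combine to minus a nonnegative quadratic form of the jump.
-/

namespace ESFlux

/-! ### Grid lines and face points -/

/-- The `r`-th point of the grid line in the direction `l` whose two transverse indices are `y`. -/
def linePt {p : ℕ} (l : Fin 3) (y : Fin 2 → Fin (p + 1)) (r : Fin (p + 1)) : Node p :=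
  Fin.insertNth (α := fun _ => Fin (p + 1)) l r y

/-- The quadrature weight of a grid line, common to all its points. -/
def LGL.lineWeight {p : ℕ} (L : LGL p) (y : Fin 2 → Fin (p + 1)) : ℝ := ∏ m, L.P (y m)

@[simp] theorem linePt_same {p : ℕ} (l : Fin 3) (y : Fin 2 → Fin (p + 1)) (r : Fin (p + 1)) :
    linePt l y r l = r := by
  simp [linePt]

@[simp] theorem update_linePt {p : ℕ} (l : Fin 3) (y : Fin 2 → Fin (p + 1)) (r s : Fin (p + 1)) :
    Function.update (linePt l y r) l s = linePt l y s := by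
  unfold linePt
  exact Fin.update_insertNth (α := fun _ => Fin (p + 1)) l r s y

theorem sum_eq_sum_linePt {p : ℕ} (l : Fin 3) (φ : Node p → ℝ) :
    ∑ i, φ i = ∑ y : Fin 2 → Fin (p + 1), ∑ r, φ (linePt l y r) := by
  rw [← (Fin.insertNthEquiv (fun _ => Fin (p + 1)) l).sum_comp, Fintype.sum_prod_type_right]
  rfl

theorem LGL.weight_eq {p : ℕ} (L : LGL p) (l : Fin 3) (i : Node p) :
    L.weight i = L.P (i l) * L.faceWeight l i := by
  unfold LGL.weight LGL.faceWeight
  rw [Finset.mul_prod_erase Finset.univ (fun m => L.P (i m)) (Finset.mem_univ l)]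

theorem LGL.weight_linePt {p : ℕ} (L : LGL p) (l : Fin 3) (y : Fin 2 → Fin (p + 1))
    (r : Fin (p + 1)) : L.weight (linePt l y r) = L.P r * L.lineWeight y := by
  unfold LGL.weight LGL.lineWeight
  rw [Fin.prod_univ_succAbove _ l, linePt_same]
  simp [linePt]

theorem LGL.faceWeight_linePt {p : ℕ} (L : LGL p) (l : Fin 3) (y : Fin 2 → Fin (p + 1))
    (r : Fin (p + 1)) : L.faceWeight l (linePt l y r) = L.lineWeight y := by
  have h := L.weight_eq l (linePt l y r)
  rw [L.weight_linePt, linePt_same] at h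
  exact (mul_left_cancel₀ (L.P_pos r).ne' h).symm

theorem LGL.lineWeight_pos {p : ℕ} (L : LGL p) (y : Fin 2 → Fin (p + 1)) : 0 < L.lineWeight y :=
  Finset.prod_pos fun _ _ => L.P_pos _

theorem LGL.weight_pos {p : ℕ} (L : LGL p) (i : Node p) : 0 < L.weight i :=
  Finset.prod_pos fun _ _ => L.P_pos _

theorem LGL.faceWeight_pos {p : ℕ} (L : LGL p) (l : Fin 3) (i : Node p) : 0 < L.faceWeight l i :=
  Finset.prod_pos fun _ _ => L.P_pos _

/-- The weight `P_l⁻¹` in front of a term of direction `l` turns the volume quadrature into a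
quadrature over grid lines. -/
theorem LGL.sum_weight_inv {p : ℕ} (L : LGL p) (l : Fin 3) (φ : Node p → ℝ) :
    ∑ i, L.weight i * ((L.P (i l))⁻¹ * φ i) =
      ∑ y, L.lineWeight y * ∑ r, φ (linePt l y r) := by
  rw [sum_eq_sum_linePt l]
  refine Finset.sum_congr rfl fun y _ => ?_
  rw [Finset.mul_sum]
  refine Finset.sum_congr rfl fun r _ => ?_
  rw [L.weight_linePt, linePt_same]
  have := (L.P_pos r).ne'
  field_simp

theorem sum_endIdx {p : ℕ} (l : Fin 3) (s : Bool) (φ : Node p → ℝ) :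
    ∑ i : Node p, (if i l = endIdx p s then φ i else 0) = ∑ y, φ (linePt l y (endIdx p s)) := by
  rw [sum_eq_sum_linePt l]
  refine Finset.sum_congr rfl fun y _ => ?_
  simp

theorem sum_faceNode {p : ℕ} {E : Type*} [Fintype E] (φ : FaceNode p E → ℝ) :
    ∑ f, φ f = ∑ k, ∑ l, ∑ s, ∑ i : Node p,
      if h : i l = endIdx p s then φ ⟨(k, l, s, i), h⟩ else 0 := by
  classical
  let Φ : E × Fin 3 × Bool × Node p → ℝ := fun x =>
    if h : x.2.2.2 x.2.1 = endIdx p x.2.2.1 then φ ⟨x, h⟩ else 0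
  have h1 : ∑ f, φ f = ∑ x, Φ x := by
    have h2 : ∑ x, Φ x =
        ∑ x ∈ Finset.univ.filter (fun x : E × Fin 3 × Bool × Node p =>
          x.2.2.2 x.2.1 = endIdx p x.2.2.1), Φ x := by
      rw [Finset.sum_filter]
      refine Finset.sum_congr rfl fun x _ => ?_
      by_cases h : x.2.2.2 x.2.1 = endIdx p x.2.2.1 <;> simp [Φ, h]
    rw [h2, Finset.sum_subtype (p := fun x : E × Fin 3 × Bool × Node p =>
      x.2.2.2 x.2.1 = endIdx p x.2.2.1) _ (by simp) Φ]
    refine Finset.sum_congr rfl fun x _ => ?_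
    have hx := x.2
    simp only [Φ]
    rw [dif_pos hx]
    rfl
  rw [h1]
  simp only [Fintype.sum_prod_type]
  rfl

/-- Face quadrature of a function that is defined at all solution points, by grid lines. -/
theorem sum_faceWeight_eq_sum_line {p : ℕ} {E : Type*} [Fintype E] (L : LGL p)
    (φ : E → Fin 3 → Bool → Node p → ℝ) :
    ∑ f : FaceNode p E, L.faceWeight f.dir f.pt * φ f.elem f.dir f.side f.pt =
      ∑ k, ∑ l, ∑ y, L.lineWeight y *
        (φ k l true (linePt l y (Fin.last p)) + φ k l false (linePt l y 0)) := by
  rw [sum_faceNode]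
  refine Finset.sum_congr rfl fun k _ => Finset.sum_congr rfl fun l _ => ?_
  have h : ∀ s : Bool, (∑ i : Node p, if h : i l = endIdx p s then
      L.faceWeight (FaceNode.dir (⟨(k, l, s, i), h⟩ : FaceNode p E))
          (FaceNode.pt (⟨(k, l, s, i), h⟩ : FaceNode p E)) *
        φ (FaceNode.elem (⟨(k, l, s, i), h⟩ : FaceNode p E))
          (FaceNode.dir (⟨(k, l, s, i), h⟩ : FaceNode p E))
          (FaceNode.side (⟨(k, l, s, i), h⟩ : FaceNode p E))
          (FaceNode.pt (⟨(k, l, s, i), h⟩ : FaceNode p E)) else 0) =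
      ∑ y, L.lineWeight y * φ k l s (linePt l y (endIdx p s)) := by
    intro s
    have := sum_endIdx l s (fun i : Node p => L.faceWeight l i * φ k l s i)
    simp only [L.faceWeight_linePt] at this
    rw [← this]
    refine Finset.sum_congr rfl fun i _ => ?_
    by_cases hi : i l = endIdx p s
    · rw [dif_pos hi, if_pos hi]; rfl
    · rw [dif_neg hi, if_neg hi]
  simp only [h, Fintype.sum_bool, mul_add, Finset.sum_add_distrib]
  rfl

/-- Penalties enter the volume quadrature through the face quadrature. -/
theorem sum_weight_facePenalty {p : ℕ} {E : Type*} [Fintype E] (L : LGL p)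
    (v : E → Fin 3 → Node p → Vec5) (g : FaceNode p E → Vec5) :
    ∑ k, ∑ i, L.weight i * ∑ l, v k l i ⬝ᵥ ((L.P (i l))⁻¹ • facePenalty g k l i) =
      ∑ f : FaceNode p E, L.faceWeight f.dir f.pt * (v f.elem f.dir f.pt ⬝ᵥ g f) := by
  rw [sum_faceNode]
  refine Finset.sum_congr rfl fun k _ => ?_
  simp only [Finset.mul_sum]
  rw [Finset.sum_comm]
  refine Finset.sum_congr rfl fun l _ => ?_
  rw [Finset.sum_comm (s := (Finset.univ : Finset Bool))]
  refine Finset.sum_congr rfl fun i _ => ?_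
  unfold facePenalty
  rw [dotProduct_smul, dotProduct_sum, smul_eq_mul, Finset.mul_sum, Finset.mul_sum]
  refine Finset.sum_congr rfl fun s _ => ?_
  by_cases hi : i l = endIdx p s
  · rw [dif_pos hi, dif_pos hi, L.weight_eq l i]
    have := (L.P_pos (i l)).ne'
    have hd : FaceNode.dir (⟨(k, l, s, i), hi⟩ : FaceNode p E) = l := rfl
    have hp : FaceNode.pt (⟨(k, l, s, i), hi⟩ : FaceNode p E) = i := rfl
    have he : FaceNode.elem (⟨(k, l, s, i), hi⟩ : FaceNode p E) = k := rfl
    rw [hd, hp, he]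
    field_simp
  · rw [dif_neg hi, dif_neg hi]
    simp

/-! ### Interfaces and the physical boundary -/

/-- The gluing pairs up the interface points, so a face sum whose two contributions at every
interface add up to at most zero is bounded by its part on the physical boundary. -/
theorem sum_faceWeight_le_boundarySum {p : ℕ} {E : Type*} [Fintype E] {L : LGL p}
    (M : HexMesh L E) (φ ψ : FaceNode p E → ℝ)
    (hbd : ∀ f, M.nbr f = none → φ f = ψ f)
    (hint : ∀ f g, M.nbr f = some g → φ f + φ g ≤ 0) :
    ∑ f : FaceNode p E, L.faceWeight f.dir f.pt * φ f ≤ boundarySum M ψ := by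
  let χ : FaceNode p E → ℝ := fun f =>
    L.faceWeight f.dir f.pt * φ f -
      match M.nbr f with
      | none => L.faceWeight f.dir f.pt * ψ f
      | some _ => 0
  have hχ : ∑ f, χ f ≤ 0 := by
    -- The gluing as an involution of all face points, the boundary points being fixed.
    let σ : FaceNode p E → FaceNode p E := fun f => (M.nbr f).getD f
    have hσ : Function.Involutive σ := by
      intro f
      cases hf : M.nbr f with
      | none => simp [σ, hf]
      | some g => simp [σ, hf, M.nbr_symm f g hf]
    have hsum : ∑ f, χ (σ f) = ∑ f, χ f := Equiv.sum_comp hσ.toPerm χ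
    have hle : ∑ f, (χ f + χ (σ f)) ≤ 0 := by
      refine Finset.sum_nonpos fun f _ => ?_
      cases hf : M.nbr f with
      | none => simp [σ, χ, hf, hbd f hf]
      | some g =>
        have hg := M.nbr_symm f g hf
        simp only [σ, χ, hf, hg, Option.getD_some, sub_zero]
        rw [← M.weight_match f g hf, ← mul_add]
        exact mul_nonpos_of_nonneg_of_nonpos (L.faceWeight_pos _ _).le (hint f g hf)
    rw [Finset.sum_add_distrib, hsum] at hle
    linarith
  simp only [χ, Finset.sum_sub_distrib] at hχ
  exact sub_nonpos.1 hχ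

theorem boundarySum_eq_zero {p : ℕ} {E : Type*} [Fintype E] {L : LGL p} (M : HexMesh L E)
    (h : ∀ f, M.nbr f ≠ none) (φ : FaceNode p E → ℝ) : boundarySum M φ = 0 := by
  unfold boundarySum
  refine Finset.sum_eq_zero fun f _ => ?_
  cases hf : M.nbr f with
  | none => exact absurd hf (h f)
  | some g => rfl

theorem HexMesh.normal_nbr {p : ℕ} {E : Type*} {L : LGL p} (M : HexMesh L E)
    {f g : FaceNode p E} (h : M.nbr f = some g) : M.normal g = -M.normal f :=
  funext fun m => M.normal_match f g h m

/-! ### Summation by parts on a line -/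

/-- Constants are differentiated exactly. -/
theorem LGL.sum_Q_row {p : ℕ} (L : LGL p) (i : Fin (p + 1)) : ∑ j, L.Q i j = 0 := by
  simpa using L.exact (Polynomial.C 1) (by simp) i

/-- Summation by parts in one dimension. -/
theorem LGL.sum_mul_Q {p : ℕ} (L : LGL p) (x y : Fin (p + 1) → ℝ) :
    ∑ r, x r * ∑ j, L.Q r j * y j =
      x (Fin.last p) * y (Fin.last p) - x 0 * y 0 - ∑ r, (∑ j, L.Q r j * x j) * y r := by
  have h : ∑ r, ∑ j, x r * y j * (L.Q r j + L.Q j r) =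
      x (Fin.last p) * y (Fin.last p) - x 0 * y 0 := by
    simp [L.sbp, mul_sub, Finset.sum_sub_distrib]
  have h2 : ∑ r, (∑ j, L.Q r j * x j) * y r = ∑ r, ∑ j, x r * y j * L.Q j r := by
    rw [Finset.sum_comm]
    refine Finset.sum_congr rfl fun r _ => ?_
    rw [Finset.sum_mul]
    exact Finset.sum_congr rfl fun j _ => by ring
  have h3 : ∑ r, x r * ∑ j, L.Q r j * y j = ∑ r, ∑ j, x r * y j * L.Q r j := by
    refine Finset.sum_congr rfl fun r _ => ?_
    rw [Finset.mul_sum]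
    exact Finset.sum_congr rfl fun j _ => by ring
  rw [h2, h3, ← h]
  simp only [mul_add, Finset.sum_add_distrib]
  ring

theorem LGL.sum_dotProduct_Q {p : ℕ} (L : LGL p) (x y : Fin (p + 1) → Vec5) :
    ∑ r, x r ⬝ᵥ ∑ j, L.Q r j • y j =
      x (Fin.last p) ⬝ᵥ y (Fin.last p) - x 0 ⬝ᵥ y 0 - ∑ r, (∑ j, L.Q r j • x j) ⬝ᵥ y r := by
  simp only [dotProduct, Finset.sum_apply, Pi.smul_apply, smul_eq_mul]
  rw [Finset.sum_comm, Finset.sum_comm (s := (Finset.univ : Finset (Fin (p + 1))))]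
  simp only [L.sum_mul_Q (fun r => x r _) (fun r => y r _), Finset.sum_sub_distrib]

/-- The flux form of the split derivative: for the symmetric products of `a` and `ψ`, the pairs
`r < j` sum up to the boundary terms minus `∑ ψ Q a`. -/
theorem LGL.sum_lt_Q {p : ℕ} (L : LGL p) (a ψ : Fin (p + 1) → ℝ) :
    ∑ r, ∑ j, (if r < j then 2 * L.Q r j * ((a r + a j) / 2) * (ψ j - ψ r) else 0) =
      a (Fin.last p) * ψ (Fin.last p) - a 0 * ψ 0 - ∑ r, ψ r * ∑ j, L.Q r j * a j := by
  let K : Fin (p + 1) → Fin (p + 1) → ℝ := fun r j => L.Q r j * (a r + a j) * (ψ j - ψ r)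
  -- Off the diagonal `Q` is antisymmetric, as is `ψ j - ψ r`; on the diagonal `K` vanishes.
  have hK : ∀ r j, K r j = K j r := by
    intro r j
    by_cases h : r = j
    · rw [h]
    · have := L.sbp r j
      rw [if_neg h] at this
      simp only [K]
      linear_combination ((a r + a j) * (ψ j - ψ r)) * this
  have hhalf : ∑ r, ∑ j, K r j = 2 * ∑ r, ∑ j, (if r < j then K r j else 0) := by
    have h1 : ∀ r j, K r j = (if r < j then K r j else 0) + if j < r then K j r else 0 := by
      intro r j
      rcases lt_trichotomy r j with h | h | h
      · simp [h, h.not_gt]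
      · simp [h, K]
      · simp [h, h.not_gt, hK r j]
    have h2 : ∑ r, ∑ j, (if j < r then K j r else 0) = ∑ r, ∑ j, (if r < j then K r j else 0) :=
      Finset.sum_comm
    calc ∑ r, ∑ j, K r j
        = ∑ r, ∑ j, ((if r < j then K r j else 0) + if j < r then K j r else 0) :=
          Finset.sum_congr rfl fun r _ => Finset.sum_congr rfl fun j _ => h1 r j
      _ = _ := by simp only [Finset.sum_add_distrib]; rw [h2]; ring
  have hL : ∑ r, ∑ j, (if r < j then 2 * L.Q r j * ((a r + a j) / 2) * (ψ j - ψ r) else 0) =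
      ∑ r, ∑ j, (if r < j then K r j else 0) := by
    refine Finset.sum_congr rfl fun r _ => Finset.sum_congr rfl fun j _ => ?_
    split_ifs
    · simp only [K]; ring
    · rfl
  have hexp : ∑ r, ∑ j, K r j =
      (∑ r, a r * ∑ j, L.Q r j * ψ j) - (∑ r, a r * ψ r * ∑ j, L.Q r j)
        + (∑ r, 1 * ∑ j, L.Q r j * (a j * ψ j)) - ∑ r, ψ r * ∑ j, L.Q r j * a j := by
    simp only [Finset.mul_sum, ← Finset.sum_sub_distrib, ← Finset.sum_add_distrib]
    refine Finset.sum_congr rfl fun r _ => Finset.sum_congr rfl fun j _ => ?_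
    simp only [K]; ring
  have hA := L.sum_mul_Q a ψ
  have hB := L.sum_mul_Q (fun _ => 1) (fun r => a r * ψ r)
  simp only [mul_one, L.sum_Q_row, zero_mul, Finset.sum_const_zero, sub_zero] at hB
  have hC : ∑ r, (∑ j, L.Q r j * a j) * ψ r = ∑ r, ψ r * ∑ j, L.Q r j * a j :=
    Finset.sum_congr rfl fun r _ => mul_comm _ _
  simp only [L.sum_Q_row, mul_zero, Finset.sum_const_zero, sub_zero] at hexp
  rw [hL]
  linarith

/-! ### Telescopic fluxes on a line -/

@[simp] theorem lineFlux_first {p : ℕ} (a : Vec5) (f : Fin p → Vec5) (b : Vec5) :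
    lineFlux a f b 0 = a := rfl

@[simp] theorem lineFlux_last {p : ℕ} (a : Vec5) (f : Fin p → Vec5) (b : Vec5) :
    lineFlux a f b (Fin.last (p + 1)) = b := by
  unfold lineFlux
  rw [← Fin.succ_last, Fin.cons_succ, Fin.snoc_last]

@[simp] theorem lineFlux_inner {p : ℕ} (a : Vec5) (f : Fin p → Vec5) (b : Vec5) (c : Fin p) :
    lineFlux a f b c.castSucc.succ = f c := by
  unfold lineFlux
  rw [Fin.cons_succ, Fin.snoc_castSucc]

/-- Summation by parts for the difference from flux points to solution points. -/
theorem sum_dotProduct_telescope {p : ℕ} (w : Fin (p + 1) → Vec5) (f : Fin (p + 2) → Vec5) :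
    ∑ r, w r ⬝ᵥ (f r.succ - f r.castSucc) =
      w (Fin.last p) ⬝ᵥ f (Fin.last (p + 1)) - w 0 ⬝ᵥ f 0
        - ∑ c : Fin p, (w c.succ - w c.castSucc) ⬝ᵥ f c.castSucc.succ := by
  simp only [dotProduct_sub, sub_dotProduct, Finset.sum_sub_distrib]
  rw [Fin.sum_univ_castSucc (fun r : Fin (p + 1) => w r ⬝ᵥ f r.succ),
    Fin.sum_univ_succ (fun r : Fin (p + 1) => w r ⬝ᵥ f r.castSucc)]
  simp only [Fin.succ_last, Fin.castSucc_zero, Fin.succ_castSucc]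
  ring

/-- The flux points `c` with `r ≤ c < j` are those between the solution points `r` and `j`. -/
theorem sum_between_sub {p : ℕ} (x : Fin (p + 1) → ℝ) (r j : Fin (p + 1)) (h : r ≤ j) :
    ∑ c : Fin p, (if c.succ ≤ j ∧ r ≤ c.castSucc then x c.succ - x c.castSucc else 0) =
      x j - x r := by
  induction j using Fin.induction with
  | zero =>
    have : r = 0 := le_antisymm h (Fin.zero_le r)
    subst this
    simp
  | succ s ih =>
    rcases eq_or_lt_of_le h with rfl | hlt
    · rw [sub_self]
      refine Finset.sum_eq_zero fun c _ => if_neg ?_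
      simp only [Fin.le_def, Fin.val_succ, Fin.val_castSucc]
      omega
    · have hrs : r ≤ s.castSucc := by
        simp only [Fin.lt_def, Fin.le_def, Fin.val_succ, Fin.val_castSucc] at *
        omega
      have hsplit : ∀ c : Fin p,
          (if c.succ ≤ s.succ ∧ r ≤ c.castSucc then x c.succ - x c.castSucc else 0) =
          (if c.succ ≤ s.castSucc ∧ r ≤ c.castSucc then x c.succ - x c.castSucc else 0) +
            if c = s then x c.succ - x c.castSucc else 0 := by
        intro c
        by_cases hc : c = s
        · subst hc
          simp [hrs]
        · have : (c.succ ≤ s.succ ↔ c.succ ≤ s.castSucc) := by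
            have hc' : (c : ℕ) ≠ s := fun h => hc (Fin.ext h)
            simp only [Fin.le_def, Fin.val_succ, Fin.val_castSucc]
            omega
          simp [hc, this]
      simp only [hsplit, Finset.sum_add_distrib, ih hrs]
      simp

/-- Abel summation: each pair `r < j` is seen by all flux points between `r` and `j`, at which the
jumps of `x` telescope. -/
theorem sum_jump_mul_sum {p : ℕ} (x : Fin (p + 1) → ℝ) (K : Fin (p + 1) → Fin (p + 1) → ℝ) :
    ∑ c : Fin p, (x c.succ - x c.castSucc) *
        ∑ j ∈ Finset.Ici c.succ, ∑ r ∈ Finset.Iic c.castSucc, K r j =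
      ∑ r, ∑ j, if r < j then K r j * (x j - x r) else 0 := by
  have h1 : ∀ c : Fin p, (x c.succ - x c.castSucc) *
        ∑ j ∈ Finset.Ici c.succ, ∑ r ∈ Finset.Iic c.castSucc, K r j =
      ∑ r, ∑ j, K r j *
        if c.succ ≤ j ∧ r ≤ c.castSucc then x c.succ - x c.castSucc else 0 := by
    intro c
    have hj : Finset.Ici c.succ = Finset.univ.filter (fun j => c.succ ≤ j) := by ext; simp
    have hr : Finset.Iic c.castSucc = Finset.univ.filter (fun r => r ≤ c.castSucc) := by ext; simp
    rw [hj, hr, Finset.sum_filter, Finset.mul_sum, Finset.sum_comm]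
    refine Finset.sum_congr rfl fun j _ => ?_
    rw [Finset.sum_filter]
    by_cases h : c.succ ≤ j
    · simp only [h, if_true, true_and, Finset.mul_sum]
      refine Finset.sum_congr rfl fun r _ => ?_
      split_ifs <;> ring
    · simp [h]
  simp only [h1]
  rw [Finset.sum_comm]
  refine Finset.sum_congr rfl fun r _ => ?_
  rw [Finset.sum_comm]
  refine Finset.sum_congr rfl fun j _ => ?_
  rw [← Finset.mul_sum]
  split_ifs with h
  · rw [sum_between_sub x r j h.le]
  · refine mul_eq_zero_of_right _ (Finset.sum_eq_zero fun c _ => if_neg ?_)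
    simp only [Fin.le_def, Fin.lt_def, Fin.val_succ, Fin.val_castSucc] at *
    omega

theorem sum_jump_dotProduct_sum {p : ℕ} (x : Fin (p + 1) → Vec5)
    (K : Fin (p + 1) → Fin (p + 1) → Vec5) :
    ∑ c : Fin p, (x c.succ - x c.castSucc) ⬝ᵥ
        ∑ j ∈ Finset.Ici c.succ, ∑ r ∈ Finset.Iic c.castSucc, K r j =
      ∑ r, ∑ j, if r < j then (x j - x r) ⬝ᵥ K r j else 0 := by
  simp only [dotProduct, Finset.sum_apply, Pi.sub_apply]
  rw [Finset.sum_comm]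
  have h := fun a => sum_jump_mul_sum (fun r => x r a) (fun r j => K r j a)
  rw [Finset.sum_congr rfl fun a _ => h a, Finset.sum_comm]
  refine Finset.sum_congr rfl fun r _ => ?_
  rw [Finset.sum_comm]
  refine Finset.sum_congr rfl fun j _ => ?_
  split_ifs
  · exact Finset.sum_congr rfl fun a _ => mul_comm _ _
  · simp

theorem dotProduct_contract (x : Vec5) (n : Fin 3 → ℝ) (f : Fin 3 → Vec5) :
    x ⬝ᵥ contract n f = ∑ m, n m * (x ⬝ᵥ f m) := by
  simp [contract, dotProduct_sum, dotProduct_smul]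

theorem contract_neg (n : Fin 3 → ℝ) (f : Fin 3 → Vec5) : contract (-n) f = -contract n f := by
  simp [contract]

/-! ### Dissipativity of the Brenner and Merriam-Roe fluxes -/

theorem dotProduct_vec5 (x : Vec5) (a : ℝ) (b : Fin 3 → ℝ) (c : ℝ) :
    x ⬝ᵥ vec5 a b c = x 0 * a + ∑ i, momPart x i * b i + x 4 * c := by
  simp [dotProduct, vec5, momPart, Fin.sum_univ_succ]
  ring

/-- The Newtonian stress of a velocity gradient `S` does nonnegative work on `S`: half the squared
norm of the trace-free part of `S + Sᵀ`, here written as an explicit sum of squares. -/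
theorem symmetric_stress_nonneg (S : Fin 3 → Fin 3 → ℝ) :
    0 ≤ ∑ m, ∑ i, (S i m + S m i - if i = m then 2 / 3 * ∑ r, S r r else 0) * S i m := by
  have h : ∑ m, ∑ i, (S i m + S m i - if i = m then 2 / 3 * ∑ r, S r r else 0) * S i m =
      (S 0 1 + S 1 0) ^ 2 + (S 0 2 + S 2 0) ^ 2 + (S 1 2 + S 2 1) ^ 2
        + 2 / 3 * ((S 0 0 - S 1 1) ^ 2 + (S 1 1 - S 2 2) ^ 2 + (S 2 2 - S 0 0) ^ 2) := by
    simp [Fin.sum_univ_three]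
    ring
  rw [h]
  positivity

/-- The quadratic form of the Brenner coefficient matrices is the sum of a viscous heating, a heat
conduction and a mass diffusion term, each nonnegative. -/
theorem brennerFlux_nonneg (G : Gas) {μ κ σ : ℝ} (hμ : 0 ≤ μ) (hκ : 0 ≤ κ) (hσ : 0 ≤ σ)
    (A : TransportState) (hρ : 0 < A.rho) (hT : 0 < A.tempStress) (Θ : Fin 3 → Vec5) :
    0 ≤ ∑ m, Θ m ⬝ᵥ brennerFlux G μ κ σ A Θ m := by
  let S : Fin 3 → Fin 3 → ℝ := fun i j => momPart (Θ j) i + A.vel i * Θ j 4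
  let Z : Fin 3 → ℝ := fun j => Θ j 0 + (∑ i, A.vel i * momPart (Θ j) i) + A.energy * Θ j 4
  have h : ∀ m, Θ m ⬝ᵥ brennerFlux G μ κ σ A Θ m =
      μ * A.tempStress *
          ∑ i, (S i m + S m i - if i = m then 2 / 3 * ∑ r, S r r else 0) * S i m
        + κ * (A.tempHeat * Θ m 4) ^ 2 + σ * (A.rho / G.R) * Z m ^ 2 := by
    intro m
    simp only [brennerFlux, dotProduct_add, dotProduct_smul, dotProduct_vec5, smul_eq_mul]
    fin_cases m <;> simp [S, Z, Fin.sum_univ_three] <;> ring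
  simp only [h, Finset.sum_add_distrib, ← Finset.mul_sum]
  have hR := G.R_pos
  have := symmetric_stress_nonneg S
  positivity

/-- The two elements at an interface see opposite normals and opposite jumps, hence opposite
two-point fluxes. -/
theorem normalBrenner_neg_neg (G : Gas) (μ κ σ : ℝ) (A : TransportState) (n : Fin 3 → ℝ)
    (δ : Vec5) : normalBrenner G μ κ σ A (-n) (-δ) = -normalBrenner G μ κ σ A n δ := by
  simp [normalBrenner, contract_neg]

theorem normalBrenner_nonneg (G : Gas) {μ κ σ : ℝ} (hμ : 0 ≤ μ) (hκ : 0 ≤ κ) (hσ : 0 ≤ σ)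
    (A : TransportState) (hρ : 0 < A.rho) (hT : 0 < A.tempStress) (n : Fin 3 → ℝ) (δ : Vec5) :
    0 ≤ δ ⬝ᵥ normalBrenner G μ κ σ A n δ := by
  have h := brennerFlux_nonneg G hμ hκ hσ A hρ hT (fun j => n j • δ)
  simpa [normalBrenner, dotProduct_contract, smul_dotProduct] using h

/-- `Y |Λ| Yᵀ` is positive semidefinite. This uses only the signs of the coefficients, so that the
degenerate normal `n = 0`, where the unit vector `ν` is the junk value `0`, needs no exception. -/
theorem roeDissipation_nonneg (G : Gas) (U : Vec5) (hU : Admissible G U) (n : Fin 3 → ℝ)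
    (x : Vec5) : 0 ≤ x ⬝ᵥ roeDissipation G U n x := by
  have hρ := hU.1
  have hT := hU.2
  have hR := G.R_pos
  have hγ : 0 < G.gamma - 1 := sub_pos.2 G.gamma_gt_one
  have hγ' : 0 < G.gamma := by linarith
  have key : ∀ (a b : ℝ) (r : Vec5), 0 ≤ a → 0 ≤ b → 0 ≤ x ⬝ᵥ ((a * b * (r ⬝ᵥ x)) • r) := by
    intro a b r ha hb
    rw [dotProduct_smul, smul_eq_mul, dotProduct_comm x r, mul_assoc]
    exact mul_nonneg (mul_nonneg ha hb) (mul_self_nonneg _)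
  unfold roeDissipation
  simp only [dotProduct_add, dotProduct_sum]
  refine add_nonneg (add_nonneg (add_nonneg ?_ ?_) ?_) (Finset.sum_nonneg fun i _ => ?_) <;>
    refine key _ _ _ (abs_nonneg _) ?_ <;> positivity

theorem roeDissipation_neg (G : Gas) (U : Vec5) (n : Fin 3 → ℝ) (x : Vec5) :
    roeDissipation G U n (-x) = -roeDissipation G U n x := by
  simp only [roeDissipation, dotProduct_neg, mul_neg, neg_smul, Finset.sum_neg_distrib, neg_add]

/-- Reversing the normal exchanges the two acoustic waves. -/
theorem roeDissipation_neg_normal (G : Gas) (U : Vec5) (n : Fin 3 → ℝ) (x : Vec5) :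
    roeDissipation G U (-n) x = roeDissipation G U n x := by
  have h1 : norm3 (-n) = norm3 n := by simp [norm3]
  simp only [roeDissipation, h1, Pi.neg_apply, neg_div, mul_neg, Finset.sum_neg_distrib, neg_mul,
    neg_neg, abs_neg, sub_neg_eq_add, ← sub_eq_add_neg]
  have h2 : |-∑ i, velocity U i * n i + soundSpeed G U * norm3 n| =
      |∑ i, velocity U i * n i - soundSpeed G U * norm3 n| := by
    rw [← abs_neg]; congr 1; ring
  have h3 : |-∑ i, velocity U i * n i - soundSpeed G U * norm3 n| =
      |∑ i, velocity U i * n i + soundSpeed G U * norm3 n| := by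
    rw [← abs_neg]; congr 1; ring
  rw [h2, h3]
  abel

/-! ### Differentiation of the entropy -/

theorem Gas.cv_pos (G : Gas) : 0 < G.cv := div_pos G.R_pos (sub_pos.2 G.gamma_gt_one)

theorem differentiableAt_entropy (G : Gas) {U : Vec5} (hU : Admissible G U) :
    DifferentiableAt ℝ (entropy G) U := by
  have h0 : U 0 ≠ 0 := hU.1.ne'
  have hT : DifferentiableAt ℝ (temperature G) U := by
    have hm : ∀ i, DifferentiableAt ℝ (fun V : Vec5 => momPart V i) U := by
      intro i
      fin_cases i <;> simp [momPart] <;> fun_prop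
    change DifferentiableAt ℝ
      (fun V : Vec5 => (V 4 / V 0 - (∑ i, (momPart V i / V 0) ^ 2) / 2) / G.cv) U
    have hcv := G.cv_pos.ne'
    fun_prop (disch := assumption)
  have hd : DifferentiableAt ℝ density U := by unfold density; fun_prop
  unfold entropy thermoEntropy
  exact (hd.fun_mul
    (((hT.log hU.2.ne').const_mul _).fun_sub ((hd.log hU.1.ne').const_mul _))).fun_neg

/-- Contraction of the conserved rates with the entropy variables gives the entropy rate. -/
theorem hasDerivAt_entropy (G : Gas) {c : ℝ} (hc : 0 < c) {v : ℝ → Vec5} {t : ℝ} {r : Vec5}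
    (hv : Admissible G (v t)) (hr : ∀ a, HasDerivAt (fun τ => c * v τ a) (r a) t) :
    HasDerivAt (fun τ => c * entropy G (v τ)) (entropyVars G (v t) ⬝ᵥ r) t := by
  have hder : HasDerivAt v (c⁻¹ • r) t := by
    rw [hasDerivAt_pi]
    intro a
    have := (hr a).const_mul c⁻¹
    simpa [inv_mul_cancel_left₀ hc.ne'] using this
  have hS := ((differentiableAt_entropy G hv).hasFDerivAt.comp_hasDerivAt t hder).const_mul c
  refine hS.congr_deriv (Eq.symm ?_)
  rw [map_smul, smul_eq_mul, mul_inv_cancel_left₀ hc.ne']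
  conv_rhs => rw [pi_eq_sum_univ' r, map_sum]
  refine Finset.sum_congr rfl fun a _ => ?_
  rw [map_smul, smul_eq_mul, mul_comm]
  rfl

/-! ### Entropy conservation of the inviscid fluxes -/

section Inviscid

variable {p : ℕ} {E : Type*} {G : Gas} {L : LGL p} {M : HexMesh L E}

/-- Tadmor's condition, contracted with an arbitrary vector. -/
theorem ECFlux.sub_dotProduct_contract (F : ECFlux G) {U₁ U₂ : Vec5} (h₁ : Admissible G U₁)
    (h₂ : Admissible G U₂) (n : Fin 3 → ℝ) :
    (entropyVars G U₂ - entropyVars G U₁) ⬝ᵥ contract n (F.toFun U₁ U₂) =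
      ∑ m, n m * (entropyPotential G U₂ m - entropyPotential G U₁ m) := by
  rw [dotProduct_contract]
  refine Finset.sum_congr rfl fun m _ => ?_
  rw [F.symm _ _ h₁ h₂, F.conservative _ _ h₂ h₁]

/-- The entropy variables on the grid line `y` of direction `l`. -/
noncomputable def lineW (G : Gas) (U : GridFunction p E) (k : E) (l : Fin 3)
    (y : Fin 2 → Fin (p + 1)) (r : Fin (p + 1)) : Vec5 :=
  entropyVars G (U k (linePt l y r))

/-- The part of the work of an entropy conservative flux that is done at interior flux points:
the two-point form of `∑ a · (∂ψ/∂ξ)`. -/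
noncomputable def lineWork (M : HexMesh L E) (G : Gas) (U : GridFunction p E) (k : E) (l : Fin 3)
    (y : Fin 2 → Fin (p + 1)) : ℝ :=
  ∑ m, ∑ r, ∑ j, if r < j then
    2 * L.Q r j * ((M.metric k (linePt l y r) l m + M.metric k (linePt l y j) l m) / 2)
      * (entropyPotential G (U k (linePt l y j)) m - entropyPotential G (U k (linePt l y r)) m)
    else 0

theorem sum_jump_highFlux (F : ECFlux G) {U : GridFunction p E}
    (hU : ∀ k i, Admissible G (U k i)) (k : E) (l : Fin 3) (y : Fin 2 → Fin (p + 1))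
    (r₀ : Fin (p + 1)) :
    ∑ c : Fin p, (lineW G U k l y c.succ - lineW G U k l y c.castSucc) ⬝ᵥ
        highFlux G M F U k l (linePt l y r₀) c.castSucc.succ = lineWork M G U k l y := by
  simp only [highFlux, lineFlux_inner, update_linePt]
  rw [sum_jump_dotProduct_sum (lineW G U k l y)]
  unfold lineWork
  symm
  rw [Finset.sum_comm]
  refine Finset.sum_congr rfl fun r _ => ?_
  rw [Finset.sum_comm]
  refine Finset.sum_congr rfl fun j _ => ?_
  split_ifs
  · rw [dotProduct_smul, lineW, lineW, F.sub_dotProduct_contract (hU _ _) (hU _ _), smul_eq_mul,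
      Finset.mul_sum]
    exact Finset.sum_congr rfl fun m _ => by ring
  · simp

theorem sum_jump_lowFlux (F : ECFlux G) {U : GridFunction p E}
    (hU : ∀ k i, Admissible G (U k i)) (k : E) (l : Fin 3) (y : Fin 2 → Fin (p + 1))
    (r₀ : Fin (p + 1)) :
    ∑ c : Fin p, (lineW G U k l y c.succ - lineW G U k l y c.castSucc) ⬝ᵥ
        lowFlux G M F U k l (linePt l y r₀) c.castSucc.succ = lineWork M G U k l y := by
  simp only [lowFlux, lineFlux_inner, update_linePt, lineW]
  simp only [F.sub_dotProduct_contract (hU _ _) (hU _ _)]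
  rw [Finset.sum_comm]
  unfold lineWork
  refine Finset.sum_congr rfl fun m _ => ?_
  rw [← sum_jump_mul_sum (fun r => entropyPotential G (U k (linePt l y r)) m)
    (fun r j => 2 * L.Q r j *
      ((M.metric k (linePt l y r) l m + M.metric k (linePt l y j) l m) / 2))]
  refine Finset.sum_congr rfl fun c _ => ?_
  simp only [HexMesh.fluxMetric, update_linePt]
  ring

/-- Work of a telescoping flux, line by line. -/
theorem elemContribution_telescope (U : GridFunction p E) (k : E) (l : Fin 3) (f : PointFlux p E)
    (h : ∀ y r s, f k l (linePt l y r) = f k l (linePt l y s)) :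
    elemContribution G U L k (telescope L f k l) =
      ∑ y, L.lineWeight y *
        (lineW G U k l y (Fin.last p) ⬝ᵥ f k l (linePt l y 0) (Fin.last (p + 1))
          - lineW G U k l y 0 ⬝ᵥ f k l (linePt l y 0) 0
          - ∑ c : Fin p, (lineW G U k l y c.succ - lineW G U k l y c.castSucc) ⬝ᵥ
              f k l (linePt l y 0) c.castSucc.succ) := by
  unfold elemContribution telescope
  simp only [dotProduct_smul, smul_eq_mul]
  rw [L.sum_weight_inv l]
  refine Finset.sum_congr rfl fun y _ => ?_
  rw [← sum_dotProduct_telescope]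
  congr 1
  refine Finset.sum_congr rfl fun r _ => ?_
  rw [linePt_same, h y r 0]
  rfl

theorem highFlux_linePt (F : ECFlux G) (U : GridFunction p E) (k : E) (l : Fin 3)
    (y : Fin 2 → Fin (p + 1)) (r s : Fin (p + 1)) :
    highFlux G M F U k l (linePt l y r) = highFlux G M F U k l (linePt l y s) := by
  simp only [highFlux, endFlux, update_linePt]

theorem fluxMetric_linePt (k : E) (l : Fin 3) (y : Fin 2 → Fin (p + 1)) (r s : Fin (p + 1)) :
    M.fluxMetric k l (linePt l y r) = M.fluxMetric k l (linePt l y s) := by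
  funext c m
  simp only [HexMesh.fluxMetric, update_linePt]

theorem lowFlux_linePt (F : ECFlux G) (U : GridFunction p E) (k : E) (l : Fin 3)
    (y : Fin 2 → Fin (p + 1)) (r s : Fin (p + 1)) :
    lowFlux G M F U k l (linePt l y r) = lowFlux G M F U k l (linePt l y s) := by
  simp only [lowFlux, endFlux, fluxMetric_linePt k l y r s, update_linePt]

/-- Both entropy conservative fluxes do the same work on every line, hence so does every blend. -/
theorem elemContribution_blend (F : ECFlux G) {U : GridFunction p E}
    (hU : ∀ k i, Admissible G (U k i)) (θ : E → ℝ) (k : E) (l : Fin 3) :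
    elemContribution G U L k (telescope L
        (fun k' l' i j => θ k' • highFlux G M F U k' l' i j
          + (1 - θ k') • lowFlux G M F U k' l' i j) k l) =
      ∑ y, L.lineWeight y *
        (lineW G U k l y (Fin.last p) ⬝ᵥ endFlux G M F U k l (linePt l y 0) true
          - lineW G U k l y 0 ⬝ᵥ endFlux G M F U k l (linePt l y 0) false
          - lineWork M G U k l y) := by
  rw [elemContribution_telescope _ _ _ _ fun y r s => by
    funext j
    rw [highFlux_linePt F U k l y r s, lowFlux_linePt F U k l y r s]]
  refine Finset.sum_congr rfl fun y _ => ?_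
  have h1 := sum_jump_highFlux (M := M) F hU k l y 0
  have h2 := sum_jump_lowFlux (M := M) F hU k l y 0
  simp only [dotProduct_add, dotProduct_smul, smul_eq_mul, Finset.sum_add_distrib,
    ← Finset.mul_sum, h1, h2]
  simp only [highFlux, lowFlux, lineFlux_first, lineFlux_last]
  ring

theorem elemContribution_highFlux (F : ECFlux G) {U : GridFunction p E}
    (hU : ∀ k i, Admissible G (U k i)) (k : E) (l : Fin 3) :
    elemContribution G U L k (telescope L (highFlux G M F U) k l) =
      ∑ y, L.lineWeight y *
        (lineW G U k l y (Fin.last p) ⬝ᵥ endFlux G M F U k l (linePt l y 0) true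
          - lineW G U k l y 0 ⬝ᵥ endFlux G M F U k l (linePt l y 0) false
          - lineWork M G U k l y) := by
  simpa using elemContribution_blend (M := M) F hU (fun _ => 1) k l

/-- The interior work as a boundary term and a residual `∑ ψ Q a`, which the geometric conservation
law removes once the directions are added up. -/
theorem lineWork_eq (U : GridFunction p E) (k : E) (l : Fin 3) (y : Fin 2 → Fin (p + 1)) :
    lineWork M G U k l y =
      ∑ m, (M.metric k (linePt l y (Fin.last p)) l m *
            entropyPotential G (U k (linePt l y (Fin.last p))) m
          - M.metric k (linePt l y 0) l m * entropyPotential G (U k (linePt l y 0)) m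
          - ∑ r, entropyPotential G (U k (linePt l y r)) m *
              ∑ j, L.Q r j * M.metric k (linePt l y j) l m) :=
  Finset.sum_congr rfl fun m _ =>
    L.sum_lt_Q (fun r => M.metric k (linePt l y r) l m)
      (fun r => entropyPotential G (U k (linePt l y r)) m)

/-- The end-point flux minus the potential leaves the entropy flux. -/
theorem dotProduct_endFlux (F : ECFlux G) {U : GridFunction p E}
    (hU : ∀ k i, Admissible G (U k i)) (k : E) (l : Fin 3) (y : Fin 2 → Fin (p + 1))
    (r : Fin (p + 1)) (s : Bool) :
    lineW G U k l y (endIdx p s) ⬝ᵥ endFlux G M F U k l (linePt l y r) s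
        - ∑ m, M.metric k (linePt l y (endIdx p s)) l m *
            entropyPotential G (U k (linePt l y (endIdx p s))) m =
      ∑ m, M.metric k (linePt l y (endIdx p s)) l m *
        entropyFlux G (U k (linePt l y (endIdx p s))) m := by
  simp only [endFlux, update_linePt, dotProduct_contract, F.consistent _ (hU _ _), lineW,
    entropyPotential]
  rw [← Finset.sum_sub_distrib]
  exact Finset.sum_congr rfl fun m _ => by ring

theorem elemContribution_sum (U : GridFunction p E) (k : E) (X : Fin 3 → Node p → Vec5) :
    elemContribution G U L k (fun i => ∑ l, X l i) = ∑ l, elemContribution G U L k (X l) := by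
  unfold elemContribution
  simp only [dotProduct_sum, Finset.mul_sum]
  exact Finset.sum_comm

/-- By the geometric conservation law, the interior work of an entropy conservative flux cancels
up to boundary terms. -/
theorem elemContribution_blend_eq_outflow (F : ECFlux G) {U : GridFunction p E}
    (hU : ∀ k i, Admissible G (U k i)) (θ : E → ℝ) (k : E) :
    elemContribution G U L k (fun i => ∑ l, telescope L
        (fun k' l' i' j => θ k' • highFlux G M F U k' l' i' j
          + (1 - θ k') • lowFlux G M F U k' l' i' j) k l i) =
      elemEntropyOutflow G M U k := by
  rw [elemContribution_sum U k (fun l i => telescope L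
        (fun k' l' i' j => θ k' • highFlux G M F U k' l' i' j
          + (1 - θ k') • lowFlux G M F U k' l' i' j) k l i)]
  have hgcl : ∑ l, ∑ y, L.lineWeight y * ∑ m, ∑ r, entropyPotential G (U k (linePt l y r)) m *
      ∑ j, L.Q r j * M.metric k (linePt l y j) l m = 0 := by
    have h1 : ∀ l, ∑ y, L.lineWeight y * ∑ m, ∑ r, entropyPotential G (U k (linePt l y r)) m *
        ∑ j, L.Q r j * M.metric k (linePt l y j) l m =
        ∑ i, ∑ m, L.weight i * entropyPotential G (U k i) m *
          ((L.P (i l))⁻¹ * ∑ r, L.Q (i l) r * M.metric k (Function.update i l r) l m) := by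
      intro l
      have := L.sum_weight_inv l (fun i => ∑ m, entropyPotential G (U k i) m *
        ∑ r, L.Q (i l) r * M.metric k (Function.update i l r) l m)
      simp only [linePt_same, update_linePt] at this
      rw [Finset.sum_congr rfl fun y _ => congrArg _ Finset.sum_comm, ← this]
      refine Finset.sum_congr rfl fun i _ => ?_
      rw [Finset.mul_sum, Finset.mul_sum]
      exact Finset.sum_congr rfl fun m _ => by ring
    simp only [h1]
    rw [Finset.sum_comm]
    refine Finset.sum_eq_zero fun i _ => ?_
    rw [Finset.sum_comm]
    refine Finset.sum_eq_zero fun m _ => ?_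
    rw [← Finset.mul_sum, M.gcl k i m, mul_zero]
  have hout : elemEntropyOutflow G M U k = ∑ l, ∑ y, L.lineWeight y *
      ((∑ m, M.metric k (linePt l y (Fin.last p)) l m *
          entropyFlux G (U k (linePt l y (Fin.last p))) m)
        - ∑ m, M.metric k (linePt l y 0) l m * entropyFlux G (U k (linePt l y 0)) m) := by
    unfold elemEntropyOutflow
    refine Finset.sum_congr rfl fun l _ => ?_
    have h := fun s => sum_endIdx l s (fun i : Node p =>
      L.faceWeight l i * (sgn s * ∑ m, M.metric k i l m * entropyFlux G (U k i) m))
    rw [Fintype.sum_bool, h, h, ← Finset.sum_add_distrib]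
    refine Finset.sum_congr rfl fun y _ => ?_
    simp only [L.faceWeight_linePt, sgn, endIdx, if_true, Bool.false_eq_true, if_false]
    ring
  rw [← add_zero (elemEntropyOutflow G M U k), hout, ← hgcl, ← Finset.sum_add_distrib]
  refine Finset.sum_congr rfl fun l _ => ?_
  rw [elemContribution_blend F hU θ k l, ← Finset.sum_add_distrib]
  refine Finset.sum_congr rfl fun y _ => ?_
  have ht := dotProduct_endFlux (M := M) F hU k l y 0 true
  have hf := dotProduct_endFlux (M := M) F hU k l y 0 false
  simp only [endIdx, if_true, Bool.false_eq_true, if_false] at ht hf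
  rw [← ht, ← hf, lineWork_eq]
  simp only [Finset.sum_sub_distrib]
  ring

end Inviscid

/-! ### Entropy contributions -/

section Contributions

variable {p : ℕ} {E : Type*} {G : Gas} {L : LGL p} {M : HexMesh L E}

theorem elemContribution_add (U : GridFunction p E) (k : E) (X Y : Node p → Vec5) :
    elemContribution G U L k (fun i => X i + Y i) =
      elemContribution G U L k X + elemContribution G U L k Y := by
  simp only [elemContribution, dotProduct_add, mul_add, Finset.sum_add_distrib]

theorem elemContribution_neg (U : GridFunction p E) (k : E) (X : Node p → Vec5) :
    elemContribution G U L k (fun i => -X i) = -elemContribution G U L k X := by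
  simp only [elemContribution, dotProduct_neg, mul_neg, Finset.sum_neg_distrib]

theorem elemContribution_smul (U : GridFunction p E) (k : E) (c : ℝ) (X : Node p → Vec5) :
    elemContribution G U L k (fun i => c • X i) = c * elemContribution G U L k X := by
  simp only [elemContribution, dotProduct_smul, smul_eq_mul, Finset.mul_sum]
  exact Finset.sum_congr rfl fun i _ => by ring

theorem contribution_add [Fintype E] (U : GridFunction p E) (X Y : E → Node p → Vec5) :
    contribution G U L (fun k i => X k i + Y k i) =
      contribution G U L X + contribution G U L Y := by
  simp only [contribution, elemContribution_add, Finset.sum_add_distrib]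

theorem contribution_facePenalty [Fintype E] (U : GridFunction p E) (g : FaceNode p E → Vec5) :
    contribution G U L (fun k i => ∑ l, (L.P (i l))⁻¹ • facePenalty g k l i) =
      ∑ f : FaceNode p E, L.faceWeight f.dir f.pt * (faceW G U f ⬝ᵥ g f) := by
  have h := sum_weight_facePenalty L (fun k _ i => entropyVars G (U k i)) g
  simp only [← dotProduct_sum] at h
  exact h

/-- A two-point flux that opposes the jumps of the entropy variables and vanishes at the ends of
the lines dissipates entropy. -/
theorem elemContribution_telescope_nonpos (U : GridFunction p E) (k : E) (l : Fin 3)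
    (f : PointFlux p E) (h : ∀ y r s, f k l (linePt l y r) = f k l (linePt l y s))
    (h0 : ∀ y, f k l (linePt l y 0) 0 = 0)
    (h1 : ∀ y, f k l (linePt l y 0) (Fin.last (p + 1)) = 0)
    (hc : ∀ y (c : Fin p), 0 ≤ (lineW G U k l y c.succ - lineW G U k l y c.castSucc) ⬝ᵥ
      f k l (linePt l y 0) c.castSucc.succ) :
    elemContribution G U L k (telescope L f k l) ≤ 0 := by
  rw [elemContribution_telescope U k l f h]
  refine Finset.sum_nonpos fun y _ => mul_nonpos_of_nonneg_of_nonpos (L.lineWeight_pos y).le ?_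
  rw [h0, h1, dotProduct_zero, dotProduct_zero, sub_zero, zero_sub]
  exact neg_nonpos.2 (Finset.sum_nonneg fun c _ => hc y c)

theorem jumpW_linePt (U : GridFunction p E) (k : E) (l : Fin 3) (y : Fin 2 → Fin (p + 1))
    (r : Fin (p + 1)) (c : Fin p) :
    jumpW G U k l (linePt l y r) c = lineW G U k l y c.succ - lineW G U k l y c.castSucc := by
  simp only [jumpW, update_linePt, lineW]

/-- An interface term that is exchanged with the neighbour and opposes the jump `w' - w`
dissipates entropy. -/
theorem dotProduct_add_dotProduct_nonpos {w w' x x' : Vec5} (hx : x' = -x)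
    (h : 0 ≤ (w' - w) ⬝ᵥ x) : w ⬝ᵥ x + w' ⬝ᵥ x' ≤ 0 := by
  rw [hx, dotProduct_neg]
  rw [sub_dotProduct] at h
  linarith

end Contributions

/-! ### Inviscid terms -/

section InviscidStability

variable {p : ℕ} {E : Type*} {G : Gas} {L : LGL p} {M : HexMesh L E}

theorem sum_elemEntropyOutflow [Fintype E] (U : GridFunction p E) :
    ∑ k, elemEntropyOutflow G M U k = ∑ f : FaceNode p E, L.faceWeight f.dir f.pt *
      ∑ m, M.normal f m * entropyFlux G (faceState U f) m := by
  rw [sum_faceNode]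
  refine Finset.sum_congr rfl fun k _ => Finset.sum_congr rfl fun l _ =>
    Finset.sum_congr rfl fun s _ => Finset.sum_congr rfl fun i _ => ?_
  by_cases h : i l = endIdx p s
  · rw [if_pos h, dif_pos h, Finset.mul_sum]
    simp only [← mul_assoc]
    rfl
  · rw [if_neg h, dif_neg h]

theorem elemContribution_dissFlux_nonpos (A : StateMean G) {U : GridFunction p E}
    (hU : ∀ k i, Admissible G (U k i)) (k : E) (l : Fin 3) :
    elemContribution G U L k (telescope L (dissFlux G M A U) k l) ≤ 0 := by
  refine elemContribution_telescope_nonpos U k l _ (fun y r s => ?_) (fun y => rfl)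
    (fun y => by simp [dissFlux]) (fun y c => ?_)
  · simp only [dissFlux, update_linePt, jumpW_linePt, fluxMetric_linePt k l y r s]
  · simp only [dissFlux, lineFlux_inner, update_linePt, jumpW_linePt, dotProduct_smul, smul_eq_mul]
    exact mul_nonneg (by norm_num)
      (roeDissipation_nonneg G _ (A.admissible _ _ (hU _ _) (hU _ _)) _ _)

/-- The inviscid interface penalties replace the element fluxes by the common Merriam-Roe flux,
which dissipates entropy. -/
theorem invPenalty_pair_nonpos (D : SchemeData G M) {U : GridFunction p E}
    (hU : ∀ k i, Admissible G (U k i)) {f g : FaceNode p E} (hf : M.nbr f = some g) :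
    (-(∑ m, M.normal f m * entropyFlux G (faceState U f) m)
        + faceW G U f ⬝ᵥ D.invPenalty U f) +
      (-(∑ m, M.normal g m * entropyFlux G (faceState U g) m)
        + faceW G U g ⬝ᵥ D.invPenalty U g) ≤ 0 := by
  have hg := M.nbr_symm f g hf
  have hUf : Admissible G (faceState U f) := hU _ _
  have hUg : Admissible G (faceState U g) := hU _ _
  have hψ : ∀ (h : FaceNode p E) (n : Fin 3 → ℝ),
      ∑ m, n m * entropyPotential G (faceState U h) m =
        faceW G U h ⬝ᵥ contract n (eulerFlux G (faceState U h))
          - ∑ m, n m * entropyFlux G (faceState U h) m := by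
    intro h n
    simp only [dotProduct_contract, entropyPotential, faceW, mul_sub, Finset.sum_sub_distrib]
  have hcons := D.flux.sub_dotProduct_contract hUf hUg (M.normal f)
  have hRoe := roeDissipation_nonneg G _ (D.roeMean.admissible _ _ hUf hUg) (M.normal f)
    (faceW G U g - faceW G U f)
  have hδ : faceW G U f - faceW G U g = -(faceW G U g - faceW G U f) := by abel
  simp only [SchemeData.invPenalty, hf, hg, M.normal_nbr hf, D.flux.symm _ _ hUg hUf,
    D.roeMean.symm _ _ hUg hUf, roeDissipation_neg_normal, hδ, roeDissipation_neg, contract_neg,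
    Pi.neg_apply, neg_mul, Finset.sum_neg_distrib, dotProduct_sub, dotProduct_neg,
    dotProduct_smul, smul_eq_mul, smul_neg]
  simp only [mul_sub, Finset.sum_sub_distrib, hψ] at hcons
  change (faceW G U g - faceW G U f) ⬝ᵥ _ = _ at hcons
  rw [sub_dotProduct] at hcons hRoe
  linarith

/-- The part of the limited scheme that stems from the inviscid fluxes. -/
noncomputable def SchemeData.invTerms (D : SchemeData G M) (U : GridFunction p E) (θ : E → ℝ)
    (k : E) (i : Node p) : Vec5 :=
  (-(∑ l, telescope L
        (fun k' l' i' j => θ k' • highFlux G M D.flux U k' l' i' j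
          + (1 - θ k') • lowFlux G M D.flux U k' l' i' j) k l i)
      + (1 - θ k) • ∑ l, telescope L (dissFlux G M D.roeMean U) k l i)
    + ∑ l, (L.P (i l))⁻¹ • facePenalty (D.invPenalty U) k l i

/-- The viscous terms and the penalties are common to both schemes; the limiter thus only blends
the entropy conservative fluxes and scales the Merriam-Roe dissipation. -/
theorem SchemeData.limitedRate_eq (D : SchemeData G M) (U : GridFunction p E) (θ : E → ℝ) :
    D.limitedRate U θ = fun k i =>
      (D.invTerms U θ k i + D.viscTerms U k i) + (D.ad1Terms U θ k i + D.adpTerms U k i) := by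
  funext k i
  have hl : ∀ l, θ k • -telescope L (highFlux G M D.flux U) k l i
      + (1 - θ k) • -telescope L (merriamRoeFlux G M D.flux D.roeMean U) k l i =
      -telescope L
        (fun k' l' i' j => θ k' • highFlux G M D.flux U k' l' i' j
          + (1 - θ k') • lowFlux G M D.flux U k' l' i' j) k l i
      + (1 - θ k) • telescope L (dissFlux G M D.roeMean U) k l i := by
    intro l
    simp only [telescope, merriamRoeFlux]
    module
  have hs := Finset.sum_congr (rfl : (Finset.univ : Finset (Fin 3)) = _) fun l _ => hl l
  simp only [Finset.sum_add_distrib, ← Finset.smul_sum, Finset.sum_neg_distrib] at hs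
  simp only [limitedRate, highRate, lowRate, adRate, invTerms, Finset.sum_add_distrib,
    Finset.sum_neg_distrib]
  rw [← hs]
  module

theorem contribution_invTerms_le [Fintype E] (D : SchemeData G M) {θ : E → ℝ}
    (hθ : ∀ k, θ k ≤ 1) {U : GridFunction p E} (hU : ∀ k i, Admissible G (U k i)) :
    contribution G U L (D.invTerms U θ) ≤ D.invBoundary U := by
  have h1 : contribution G U L (D.invTerms U θ) =
      ∑ k, (-elemEntropyOutflow G M U k + (1 - θ k) *
          ∑ l, elemContribution G U L k (telescope L (dissFlux G M D.roeMean U) k l))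
        + ∑ f : FaceNode p E, L.faceWeight f.dir f.pt * (faceW G U f ⬝ᵥ D.invPenalty U f) := by
    unfold SchemeData.invTerms
    rw [contribution_add, contribution_facePenalty]
    congr 1
    refine Finset.sum_congr rfl fun k _ => ?_
    rw [elemContribution_add, elemContribution_neg, elemContribution_blend_eq_outflow D.flux hU θ k,
      elemContribution_smul,
      elemContribution_sum U k (fun l i => telescope L (dissFlux G M D.roeMean U) k l i)]
  have h2 : ∑ k, (-elemEntropyOutflow G M U k + (1 - θ k) *
          ∑ l, elemContribution G U L k (telescope L (dissFlux G M D.roeMean U) k l)) ≤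
      -∑ k, elemEntropyOutflow G M U k := by
    rw [← Finset.sum_neg_distrib]
    refine Finset.sum_le_sum fun k _ => ?_
    have := mul_nonpos_of_nonneg_of_nonpos (sub_nonneg.2 (hθ k))
      (Finset.sum_nonpos fun l (_ : l ∈ Finset.univ) =>
        elemContribution_dissFlux_nonpos (M := M) D.roeMean hU k l)
    linarith
  have h3 := sum_faceWeight_le_boundarySum M
    (fun f => -(∑ m, M.normal f m * entropyFlux G (faceState U f) m)
        + faceW G U f ⬝ᵥ D.invPenalty U f)
    (fun f => -(∑ m, M.normal f m * entropyFlux G (faceState U f) m)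
        + faceW G U f ⬝ᵥ D.bc.inviscid f)
    (fun f hf => by simp only [SchemeData.invPenalty, hf])
    (fun f g hf => invPenalty_pair_nonpos D hU hf)
  rw [sum_elemEntropyOutflow] at h2
  simp only [mul_add, mul_neg, Finset.sum_add_distrib, Finset.sum_neg_distrib] at h3
  rw [h1]
  unfold SchemeData.invBoundary
  linarith

end InviscidStability

/-! ### Diffusive terms -/

section Diffusion

variable {p : ℕ} {E : Type*} {G : Gas} {L : LGL p} {M : HexMesh L E}

/-- Summation by parts for `D_l` in the volume quadrature. -/
theorem LGL.sum_weight_deriv (L : LGL p) (l : Fin 3) (x z : Node p → Vec5) :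
    ∑ i, L.weight i * (x i ⬝ᵥ L.deriv l z i) =
      ∑ y, L.lineWeight y * (x (linePt l y (Fin.last p)) ⬝ᵥ z (linePt l y (Fin.last p))
          - x (linePt l y 0) ⬝ᵥ z (linePt l y 0))
        - ∑ i, L.weight i * (L.deriv l x i ⬝ᵥ z i) := by
  simp only [LGL.deriv, dotProduct_smul, smul_dotProduct, smul_eq_mul]
  rw [L.sum_weight_inv l, L.sum_weight_inv l, ← Finset.sum_sub_distrib]
  refine Finset.sum_congr rfl fun y _ => ?_
  simp only [linePt_same, update_linePt]
  rw [L.sum_dotProduct_Q (fun r => x (linePt l y r)) (fun r => z (linePt l y r)), mul_sub]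

theorem contract_normal (f : FaceNode p E) (q : E → Node p → Fin 3 → Vec5) :
    contract (M.normal f) (q f.elem f.pt) = sgn f.side • M.contra q f.elem f.dir f.pt := by
  simp only [contract, HexMesh.normal, HexMesh.contra, Finset.smul_sum, smul_smul]

/-- The discrete gradient is dual to the contravariant fluxes. -/
theorem sum_dotProduct_contra (D : SchemeData G M) (U : GridFunction p E)
    (q : E → Node p → Fin 3 → Vec5) (k : E) (i : Node p) :
    ∑ l, (L.deriv l (fun i' => entropyVars G (U k i')) i
        + (L.P (i l))⁻¹ • facePenalty (D.thetaPenalty U) k l i) ⬝ᵥ M.contra q k l i =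
      M.jac k i * ∑ m, D.grad U k i m ⬝ᵥ q k i m := by
  simp only [SchemeData.grad, HexMesh.contra, dotProduct_contract, sum_dotProduct,
    smul_dotProduct, smul_eq_mul, Finset.mul_sum]
  rw [Finset.sum_comm]
  refine Finset.sum_congr rfl fun m _ => Finset.sum_congr rfl fun l _ => ?_
  have := (M.jac_pos k i).ne'
  field_simp

/-- Entropy balance of a diffusive term: face terms minus the volume integral of the dissipation. -/
theorem contribution_diffusion [Fintype E] (D : SchemeData G M) (U : GridFunction p E)
    (q : E → Node p → Fin 3 → Vec5) (g : FaceNode p E → Vec5) :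
    contribution G U L (fun k i => ∑ l, (L.deriv l (M.contra q k l) i
        + (L.P (i l))⁻¹ • facePenalty g k l i)) =
      ∑ f : FaceNode p E, L.faceWeight f.dir f.pt *
          (faceW G U f ⬝ᵥ (contract (M.normal f) (q f.elem f.pt) + g f)
            + D.thetaPenalty U f ⬝ᵥ M.contra q f.elem f.dir f.pt)
        - ∑ k, ∑ i, L.weight i * (M.jac k i * ∑ m, D.grad U k i m ⬝ᵥ q k i m) := by
  have hvol : contribution G U L (fun k i => ∑ l, L.deriv l (M.contra q k l) i) =
      ∑ f : FaceNode p E, L.faceWeight f.dir f.pt *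
          (faceW G U f ⬝ᵥ contract (M.normal f) (q f.elem f.pt))
        - ∑ k, ∑ i, L.weight i *
            ∑ l, L.deriv l (fun i' => entropyVars G (U k i')) i ⬝ᵥ M.contra q k l i := by
    have hface := sum_faceWeight_eq_sum_line (E := E) L
      (fun k l s i => entropyVars G (U k i) ⬝ᵥ (sgn s • M.contra q k l i))
    have hface' : ∑ f : FaceNode p E, L.faceWeight f.dir f.pt *
          (faceW G U f ⬝ᵥ contract (M.normal f) (q f.elem f.pt)) =
        ∑ f : FaceNode p E, L.faceWeight f.dir f.pt *
          (entropyVars G (U f.elem f.pt) ⬝ᵥ (sgn f.side • M.contra q f.elem f.dir f.pt)) :=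
      Finset.sum_congr rfl fun f _ => by rw [contract_normal]; rfl
    rw [hface', hface, ← Finset.sum_sub_distrib]
    refine Finset.sum_congr rfl fun k _ => ?_
    rw [elemContribution_sum U k (fun l i => L.deriv l (M.contra q k l) i)]
    simp only [Finset.mul_sum]
    rw [Finset.sum_comm (s := (Finset.univ : Finset (Node p))), ← Finset.sum_sub_distrib]
    refine Finset.sum_congr rfl fun l _ => ?_
    rw [elemContribution, L.sum_weight_deriv l]
    congr 1
    refine Finset.sum_congr rfl fun y _ => ?_
    simp [sgn, sub_eq_add_neg]
  have hθ := sum_weight_facePenalty L (fun k l i => M.contra q k l i) (D.thetaPenalty U)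
  have hdual : ∑ k, ∑ i, L.weight i * (M.jac k i * ∑ m, D.grad U k i m ⬝ᵥ q k i m) =
      ∑ k, ∑ i, L.weight i *
            ∑ l, L.deriv l (fun i' => entropyVars G (U k i')) i ⬝ᵥ M.contra q k l i
        + ∑ k, ∑ i, L.weight i * ∑ l, M.contra q k l i ⬝ᵥ
            ((L.P (i l))⁻¹ • facePenalty (D.thetaPenalty U) k l i) := by
    simp only [← sum_dotProduct_contra, add_dotProduct, Finset.sum_add_distrib, mul_add]
    congr 1
    simp only [dotProduct_comm]
  simp only [Finset.sum_add_distrib]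
  rw [contribution_add, contribution_facePenalty, hvol, hdual, hθ]
  simp only [dotProduct_add, mul_add, Finset.sum_add_distrib, dotProduct_comm (M.contra _ _ _ _)]
  ring

/-- Centered interface fluxes, together with the jumps in the discrete gradient, exchange entropy
without producing any; what remains is an additional penalty `r` and the boundary. -/
theorem contribution_diffusion_le [Fintype E] (D : SchemeData G M) (U : GridFunction p E)
    (q : E → Node p → Fin 3 → Vec5) (g b : FaceNode p E → Vec5)
    (r : FaceNode p E → FaceNode p E → Vec5)
    (hq : ∀ k i, 0 ≤ ∑ m, D.grad U k i m ⬝ᵥ q k i m)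
    (hb : ∀ f, M.nbr f = none → g f = b f)
    (hg : ∀ f f', M.nbr f = some f' → g f =
      (1 / 2 : ℝ) • (contract (M.normal f) (q f'.elem f'.pt)
        - contract (M.normal f) (q f.elem f.pt)) + r f f')
    (hr : ∀ f f', M.nbr f = some f' → faceW G U f ⬝ᵥ r f f' + faceW G U f' ⬝ᵥ r f' f ≤ 0) :
    contribution G U L (fun k i => ∑ l, (L.deriv l (M.contra q k l) i
        + (L.P (i l))⁻¹ • facePenalty g k l i)) ≤ D.diffBoundary U q b := by
  have hdiss : 0 ≤ ∑ k, ∑ i, L.weight i * (M.jac k i * ∑ m, D.grad U k i m ⬝ᵥ q k i m) :=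
    Finset.sum_nonneg fun k _ => Finset.sum_nonneg fun i _ =>
      mul_nonneg (L.weight_pos i).le (mul_nonneg (M.jac_pos k i).le (hq k i))
  have hface := sum_faceWeight_le_boundarySum M
    (fun f => faceW G U f ⬝ᵥ (contract (M.normal f) (q f.elem f.pt) + g f)
      + D.thetaPenalty U f ⬝ᵥ M.contra q f.elem f.dir f.pt)
    (fun f => faceW G U f ⬝ᵥ (contract (M.normal f) (q f.elem f.pt) + b f)
      + D.bc.theta f ⬝ᵥ M.contra q f.elem f.dir f.pt)
    (fun f hf => by simp only [SchemeData.thetaPenalty, hf, hb f hf])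
    (fun f f' hf => by
      have hf' := M.nbr_symm f f' hf
      -- The sign in the gradient penalty turns the contravariant flux into the outward normal flux.
      have hθ : ∀ h h' : FaceNode p E, M.nbr h = some h' →
          D.thetaPenalty U h ⬝ᵥ M.contra q h.elem h.dir h.pt =
            1 / 2 * ((faceW G U h' - faceW G U h) ⬝ᵥ
              contract (M.normal h) (q h.elem h.pt)) := by
        intro h h' hh
        simp only [SchemeData.thetaPenalty, hh, contract_normal, smul_dotProduct, dotProduct_smul,
          smul_eq_mul]
        ring
      have := hr f f' hf
      rw [hθ f f' hf, hθ f' f hf', hg f f' hf, hg f' f hf', M.normal_nbr hf]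
      simp only [contract_neg, dotProduct_add, dotProduct_sub, sub_dotProduct, dotProduct_neg,
        dotProduct_smul, smul_eq_mul]
      linarith)
  rw [contribution_diffusion D]
  unfold SchemeData.diffBoundary
  linarith

theorem contribution_viscTerms_le [Fintype E] (D : SchemeData G M) {U : GridFunction p E}
    (hU : ∀ k i, Admissible G (U k i)) :
    contribution G U L (D.viscTerms U) ≤ D.viscBoundary U := by
  refine contribution_diffusion_le D U (D.viscFlux U) (D.viscPenalty U) D.bc.viscous
    (fun f g => D.ip f • normalBrenner G
          ((G.mu (temperature G (faceState U f)) + G.mu (temperature G (faceState U g))) / 2)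
          ((G.kappa (temperature G (faceState U f))
            + G.kappa (temperature G (faceState U g))) / 2)
          0 (D.mean.toFun (faceState U f) (faceState U g)) (M.normal f)
          (faceW G U g - faceW G U f))
    (fun k i => ?_) (fun f hf => ?_) (fun f g hf => ?_) (fun f g hf => ?_)
  · exact brennerFlux_nonneg G (G.mu_nonneg _ (hU k i).2) (G.kappa_nonneg _ (hU k i).2) le_rfl _
      (hU k i).1 (hU k i).2 _
  · simp only [SchemeData.viscPenalty, hf]
  · simp only [SchemeData.viscPenalty, hf]
  · have hUf : Admissible G (faceState U f) := hU _ _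
    have hUg : Admissible G (faceState U g) := hU _ _
    refine dotProduct_add_dotProduct_nonpos ?_ ?_
    · rw [← D.ip_match f g hf, D.mean.symm _ _ hUg hUf, M.normal_nbr hf, ← neg_sub (faceW G U g),
        normalBrenner_neg_neg, smul_neg, add_comm (G.mu _), add_comm (G.kappa _)]
    · rw [dotProduct_smul]
      refine mul_nonneg (D.ip_nonneg f) (normalBrenner_nonneg G ?_ ?_ le_rfl _
        (D.mean.rho_pos _ _ hUf hUg) (D.mean.tempStress_pos _ _ hUf hUg) _ _)
      · have h1 := G.mu_nonneg _ hUf.2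
        have h2 := G.mu_nonneg _ hUg.2
        positivity
      · have h1 := G.kappa_nonneg _ hUf.2
        have h2 := G.kappa_nonneg _ hUg.2
        positivity

theorem contribution_adpTerms_le [Fintype E] (D : SchemeData G M) {U : GridFunction p E}
    (hU : ∀ k i, Admissible G (U k i)) :
    contribution G U L (D.adpTerms U) ≤ D.adpBoundary U := by
  have hcT := D.av.cT_pos
  have hcρ := D.av.cRho_pos
  refine contribution_diffusion_le D U (D.adpFlux U) (D.adpPenalty U) D.bc.adp
    (fun f g => D.ip f • normalBrenner G
          ((D.av.muP f.elem f.pt + D.av.muP g.elem g.pt) / 2)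
          (D.av.cT * ((D.av.muP f.elem f.pt + D.av.muP g.elem g.pt) / 2))
          ((D.av.cRho * D.av.muP f.elem f.pt / density (faceState U f)
            + D.av.cRho * D.av.muP g.elem g.pt / density (faceState U g)) / 2)
          (D.mean.toFun (faceState U f) (faceState U g)) (M.normal f)
          (faceW G U g - faceW G U f))
    (fun k i => ?_) (fun f hf => ?_) (fun f g hf => ?_) (fun f g hf => ?_)
  · have hμ := D.av.muP_nonneg k i
    have hρ := (hU k i).1
    exact brennerFlux_nonneg G hμ (by positivity) (by positivity) _ (hU k i).1 (hU k i).2 _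
  · simp only [SchemeData.adpPenalty, hf]
  · simp only [SchemeData.adpPenalty, hf]
  · have hUf : Admissible G (faceState U f) := hU _ _
    have hUg : Admissible G (faceState U g) := hU _ _
    have hμf := D.av.muP_nonneg f.elem f.pt
    have hμg := D.av.muP_nonneg g.elem g.pt
    have hρf := hUf.1
    have hρg := hUg.1
    refine dotProduct_add_dotProduct_nonpos ?_ ?_
    · rw [← D.ip_match f g hf, D.mean.symm _ _ hUg hUf, M.normal_nbr hf, ← neg_sub (faceW G U g),
        normalBrenner_neg_neg, smul_neg, add_comm (D.av.muP g.elem g.pt),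
        add_comm (D.av.cRho * D.av.muP g.elem g.pt / _)]
    · rw [dotProduct_smul]
      exact mul_nonneg (D.ip_nonneg f) (normalBrenner_nonneg G (by positivity) (by positivity)
        (by positivity) _ (D.mean.rho_pos _ _ hUf hUg) (D.mean.tempStress_pos _ _ hUf hUg) _ _)

end Diffusion

/-! ### First-order artificial dissipation -/

section FirstOrder

variable {p : ℕ} {E : Type*} {G : Gas} {L : LGL p} {M : HexMesh L E}

theorem mu1_nonneg (D : SchemeData G M) (k : E) (l : Fin 3) (i : Node p) (c : Fin p) :
    0 ≤ D.mu1 k l i c := by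
  have h1 := D.av.muP_le k (Function.update i l c.castSucc)
  have h2 := D.av.muP_le k (Function.update i l c.succ)
  unfold SchemeData.mu1
  linarith

theorem sigmaHat_nonneg (D : SchemeData G M) (U : GridFunction p E) (k : E) (l : Fin 3)
    (i : Node p) (c : Fin p) : 0 ≤ D.sigmaHat U k l i c := by
  unfold SchemeData.sigmaHat
  split_ifs
  · exact le_max_right _ _
  · exact le_rfl

theorem mu1Face_nonneg (D : SchemeData G M) (f : FaceNode p E) : 0 ≤ D.mu1Face f :=
  sub_nonneg.2 (D.av.muP_le _ _)

theorem sigma1Face_nonneg (D : SchemeData G M) (U : GridFunction p E) (f g : FaceNode p E) :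
    0 ≤ D.sigma1Face U f g :=
  le_max_of_le_right (div_nonneg (mul_nonneg D.av.cRho_pos.le (mu1Face_nonneg D f))
    (Real.sqrt_nonneg _))

theorem mu1Face_match (D : SchemeData G M) {f g : FaceNode p E} (h : M.nbr f = some g) :
    D.mu1Face g = D.mu1Face f := by
  simp only [SchemeData.mu1Face, D.av.muAD_match f g h, D.av.muP_match f g h]

theorem sigma1Face_match (D : SchemeData G M) (U : GridFunction p E) {f g : FaceNode p E}
    (h : M.nbr f = some g) : D.sigma1Face U g f = D.sigma1Face U f g := by
  simp only [SchemeData.sigma1Face, mu1Face_match D h, D.av.chi_match f g h,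
    D.av.sigmaMinFace_match f g h, mul_comm (density (faceState U g))]

theorem twoPointFlux_linePt (D : SchemeData G M) (U : GridFunction p E)
    {μ κ σ : E → Fin 3 → Node p → Fin p → ℝ} {k : E} {l : Fin 3} {y : Fin 2 → Fin (p + 1)}
    {r s : Fin (p + 1)} (hμ : μ k l (linePt l y r) = μ k l (linePt l y s))
    (hκ : κ k l (linePt l y r) = κ k l (linePt l y s))
    (hσ : σ k l (linePt l y r) = σ k l (linePt l y s)) :
    D.twoPointFlux U μ κ σ k l (linePt l y r) = D.twoPointFlux U μ κ σ k l (linePt l y s) := by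
  simp only [SchemeData.twoPointFlux, update_linePt, jumpW_linePt, fluxMetric_linePt k l y r s,
    hμ, hκ, hσ]

theorem dotProduct_twoPointFlux_nonneg (D : SchemeData G M) {U : GridFunction p E}
    (hU : ∀ k i, Admissible G (U k i)) {μ κ σ : E → Fin 3 → Node p → Fin p → ℝ}
    (hμ : ∀ k l i c, 0 ≤ μ k l i c) (hκ : ∀ k l i c, 0 ≤ κ k l i c)
    (hσ : ∀ k l i c, 0 ≤ σ k l i c) (k : E) (l : Fin 3) (y : Fin 2 → Fin (p + 1))
    (r : Fin (p + 1)) (c : Fin p) :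
    0 ≤ (lineW G U k l y c.succ - lineW G U k l y c.castSucc) ⬝ᵥ
      D.twoPointFlux U μ κ σ k l (linePt l y r) c.castSucc.succ := by
  simp only [SchemeData.twoPointFlux, lineFlux_inner, update_linePt, jumpW_linePt,
    dotProduct_smul, smul_eq_mul]
  have hξ : 0 < L.node c.succ - L.node c.castSucc :=
    sub_pos.2 (L.node_strictMono Fin.castSucc_lt_succ)
  have h1 := M.jac_pos k (linePt l y c.castSucc)
  have h2 := M.jac_pos k (linePt l y c.succ)
  exact mul_nonneg (by positivity) (normalBrenner_nonneg G (hμ _ _ _ _) (hκ _ _ _ _) (hσ _ _ _ _)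
    _ (D.mean.rho_pos _ _ (hU _ _) (hU _ _)) (D.mean.tempStress_pos _ _ (hU _ _) (hU _ _)) _ _)

theorem elemContribution_ad1_nonpos (D : SchemeData G M) {θ : E → ℝ} (hθ : ∀ k, θ k ≤ 1)
    {U : GridFunction p E} (hU : ∀ k i, Admissible G (U k i)) (k : E) (l : Fin 3) :
    elemContribution G U L k (telescope L
      (fun k' l' i' j => (1 - θ k') • D.ad1HatFlux U k' l' i' j + D.ad1Flux U k' l' i' j) k l)
      ≤ 0 := by
  refine elemContribution_telescope_nonpos U k l _ (fun y r s => ?_) (fun y => ?_) (fun y => ?_)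
    (fun y c => ?_)
  · have hμ : D.mu1 k l (linePt l y r) = D.mu1 k l (linePt l y s) := by
      funext c
      simp only [SchemeData.mu1, update_linePt]
    have hσ : D.sigma1 U k l (linePt l y r) = D.sigma1 U k l (linePt l y s) := by
      funext c
      simp only [SchemeData.sigma1, update_linePt, hμ]
    have hσ' : D.sigmaHat U k l (linePt l y r) = D.sigmaHat U k l (linePt l y s) := by
      funext c
      simp only [SchemeData.sigmaHat, update_linePt, hσ]
    funext j
    simp only [SchemeData.ad1HatFlux, SchemeData.ad1Flux]
    rw [twoPointFlux_linePt D U (r := r) (s := s) rfl rfl hσ',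
      twoPointFlux_linePt D U (r := r) (s := s) hμ (by simp only [hμ]) hσ]
  · simp [SchemeData.ad1HatFlux, SchemeData.ad1Flux, SchemeData.twoPointFlux]
  · simp [SchemeData.ad1HatFlux, SchemeData.ad1Flux, SchemeData.twoPointFlux]
  · rw [dotProduct_add, dotProduct_smul, smul_eq_mul]
    refine add_nonneg (mul_nonneg (sub_nonneg.2 (hθ k)) ?_) ?_
    · exact dotProduct_twoPointFlux_nonneg D hU (fun _ _ _ _ => le_rfl) (fun _ _ _ _ => le_rfl)
        (sigmaHat_nonneg D U) k l y 0 c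
    · exact dotProduct_twoPointFlux_nonneg D hU (mu1_nonneg D)
        (fun k l i c => mul_nonneg D.av.cT_pos.le (mu1_nonneg D k l i c))
        (fun _ _ _ _ => le_max_left _ _) k l y 0 c

theorem contribution_ad1Terms_le [Fintype E] (D : SchemeData G M) {θ : E → ℝ}
    (hθ : ∀ k, θ k ≤ 1) {U : GridFunction p E} (hU : ∀ k i, Admissible G (U k i)) :
    contribution G U L (D.ad1Terms U θ) ≤ D.ad1Boundary U := by
  have hvol : contribution G U L (fun k i => ∑ l, telescope L
      (fun k' l' i' j => (1 - θ k') • D.ad1HatFlux U k' l' i' j + D.ad1Flux U k' l' i' j)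
        k l i) ≤ 0 := by
    refine Finset.sum_nonpos fun k _ => ?_
    rw [elemContribution_sum U k (fun l i => telescope L
      (fun k' l' i' j => (1 - θ k') • D.ad1HatFlux U k' l' i' j + D.ad1Flux U k' l' i' j) k l i)]
    exact Finset.sum_nonpos fun l _ => elemContribution_ad1_nonpos D hθ hU k l
  have hface := sum_faceWeight_le_boundarySum M
    (fun f => faceW G U f ⬝ᵥ D.ad1Penalty U f) (fun f => faceW G U f ⬝ᵥ D.bc.ad1 f)
    (fun f hf => by simp only [SchemeData.ad1Penalty, hf])
    (fun f g hf => by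
      have hg := M.nbr_symm f g hf
      have hUf : Admissible G (faceState U f) := hU _ _
      have hUg : Admissible G (faceState U g) := hU _ _
      simp only [SchemeData.ad1Penalty, hf, hg]
      refine dotProduct_add_dotProduct_nonpos ?_ ?_
      · rw [mu1Face_match D hf, sigma1Face_match D U hf, D.mean.symm _ _ hUg hUf,
          M.normal_nbr hf, ← neg_sub (faceW G U g), normalBrenner_neg_neg, smul_neg,
          add_comm (M.jac g.elem g.pt), add_comm (L.P (g.pt g.dir))]
      · rw [dotProduct_smul, smul_eq_mul]
        have h1 := M.jac_pos f.elem f.pt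
        have h2 := M.jac_pos g.elem g.pt
        have h3 := L.P_pos (f.pt f.dir)
        have h4 := L.P_pos (g.pt g.dir)
        exact mul_nonneg (by positivity) (normalBrenner_nonneg G (mu1Face_nonneg D f)
          (mul_nonneg D.av.cT_pos.le (mu1Face_nonneg D f)) (sigma1Face_nonneg D U f g) _
          (D.mean.rho_pos _ _ hUf hUg) (D.mean.tempStress_pos _ _ hUf hUg) _ _))
  unfold SchemeData.ad1Terms
  simp only [Finset.sum_add_distrib]
  rw [contribution_add, contribution_facePenalty]
  unfold SchemeData.ad1Boundary
  linarith

end FirstOrder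

end ESFlux

theorem mainTheorem2 {p : ℕ} {E : Type*} [Fintype E] (G : Gas) (L : LGL p) (M : HexMesh L E)
    (D : SchemeData G M) (θ : E → ℝ) (hθ : ∀ k, 0 ≤ θ k ∧ θ k ≤ 1)
    (U : GridFunction p E) (hU : ∀ k i, Admissible G (U k i)) :
    -- Entropy stability of the flux-limiting scheme.
    (∀ (u : ℝ → GridFunction p E) (t : ℝ), u t = U →
      (∀ k i a, HasDerivAt (fun τ => M.jac k i * u τ k i a) (D.limitedRate U θ k i a) t) →
      ∃ d : ℝ, HasDerivAt (fun τ => totalEntropy G M (u τ)) d t ∧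
        d = contribution G U L (D.limitedRate U θ) ∧
        d ≤ D.boundaryContribution U ∧
        (D.boundaryContribution U ≤ 0 → d ≤ 0) ∧
        ((∀ f, M.nbr f ≠ none) → d ≤ 0)) ∧
    -- The blended entropy conservative flux contributes what the high-order flux contributes,
    (∀ k l,
      elemContribution G U L k (telescope L
          (fun k' l' i j => θ k' • highFlux G M D.flux U k' l' i j
            + (1 - θ k') • lowFlux G M D.flux U k' l' i j) k l) =
        elemContribution G U L k (telescope L (highFlux G M D.flux U) k l)) ∧
    -- and is entropy conservative on every element.
    (∀ k,
      elemContribution G U L k (fun i => ∑ l, telescope L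
          (fun k' l' i' j => θ k' • highFlux G M D.flux U k' l' i' j
            + (1 - θ k') • lowFlux G M D.flux U k' l' i' j) k l i) =
        elemEntropyOutflow G M U k) ∧
    -- The viscous and artificial dissipation terms are entropy dissipative.
    contribution G U L (D.viscTerms U) ≤ D.viscBoundary U ∧
    contribution G U L (D.adpTerms U) ≤ D.adpBoundary U ∧
    contribution G U L (D.ad1Terms U θ) ≤ D.ad1Boundary U := by
  have hθ1 : ∀ k, θ k ≤ 1 := fun k => (hθ k).2
  have hv := contribution_viscTerms_le D hU
  have hp := contribution_adpTerms_le D hU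
  have h1 := contribution_ad1Terms_le D hθ1 hU
  refine ⟨fun u t hut hu => ?_, fun k l => ?_,
    fun k => elemContribution_blend_eq_outflow D.flux hU θ k, hv, hp, h1⟩
  · have hle : contribution G U L (D.limitedRate U θ) ≤ D.boundaryContribution U := by
      have hi := contribution_invTerms_le D hθ1 hU
      rw [D.limitedRate_eq, contribution_add, contribution_add, contribution_add]
      unfold SchemeData.boundaryContribution
      linarith
    refine ⟨_, ?_, rfl, hle, hle.trans, fun hper => hle.trans_eq ?_⟩
    · unfold totalEntropy contribution elemContribution
      refine HasDerivAt.fun_sum fun k _ => HasDerivAt.fun_sum fun i _ => ?_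
      have hd := hasDerivAt_entropy G (M.jac_pos k i) (v := fun τ => u τ k i) (t := t)
        (r := D.limitedRate U θ k i) (by rw [hut]; exact hU k i) (hu k i)
      rw [hut] at hd
      exact hd.const_mul _
    · simp only [SchemeData.boundaryContribution, SchemeData.invBoundary, SchemeData.viscBoundary,
        SchemeData.adpBoundary, SchemeData.ad1Boundary, SchemeData.diffBoundary,
        boundarySum_eq_zero M hper, add_zero]
  · rw [elemContribution_blend D.flux hU θ k l, elemContribution_highFlux D.flux hU k l]
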